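/- \textbf{Notation.} For an index $\mathbf a=(a_1,\dots,a_n)$ of integers write $|\mathbf a|=a_1+\dots+a_n$, $\mathbf a_-=(a_1,\dots,a_{n-1})$, and $\mathbf 1_n=(1,\dots,1)$. Let $A(\theta)=\log|2\sin(\theta/2)|$ and, for $\mathbf k\in\mathbb N^n$, $\mathbf l\in(\mathbb Z_{\ge0})^n$, $$\mathrm{Ls}_{\mathbf k}^{\mathbf l}(\sigma)=(-1)^n\int_0^\sigma\int_0^{\theta_n}\cdots\int_0^{\theta_2}\prod_{u=1}^n\theta_u^{l_u}A(\theta_u)^{k_u-1-l_u}\,d\theta_1\cdots d\theta_n,\qquad \mathrm{Ls}_\emptyset^\emptyset(\sigma)=1.$$ An index $\mathbf k$ is admissible if its entries are positive and $k_n\ge2$, or if it is empty. Put $$\mathrm{Li}_{\mathbf k}(z)=\sum_{0<m_1<\dots<m_n}\frac{z^{m_n}}{m_1^{k_1}\cdots m_n^{k_n}},\qquad \zeta(\mathbf k)=\sum_{0<m_1<\dots<m_n}\frac{1}{m_1^{k_1}\cdots m_n^{k_n}},$$ with $\mathrm{Li}_\emptyset(z)=\zeta(\emptyset)=1$; for admissible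 $\mathbf k$ these converge absolutely for $|z|\le1$. Let $B_\emptyset=1$, $B_{\mathbf q}=\frac{1}{|\mathbf q|+n}B_{\mathbf q_-}$, and $C_\emptyset^\emptyset=1$, $C_{\mathbf q}^{\mathbf j}=(-1)^{j_n}\frac{(|\mathbf q|-|\mathbf j_-|)!}{(|\mathbf q|-|\mathbf j|)!}C_{\mathbf q_-}^{\mathbf j_-}$. For $\mathbf j,\mathbf q\in(\mathbb Z_{\ge0})^n$ write $\mathbf j\preceq\mathbf q$ if $j_1+\dots+j_m\le q_1+\dots+q_m$ for all $m\le n$. In $\mathbb Q\langle e_0,e_1\rangle$ with (bilinear) shuffle product $\sqcup\!\sqcup$ let $w_\emptyset^\emptyset=1$ and $w_{\mathbf j}^{\mathbf r}=(w_{\mathbf j_-}^{\mathbf r_-}\mathbin{\sqcup\!\sqcup}e_1^{\sqcup\!\sqcup\, r_n})e_0^{1+j_n}$, where $e_1^{\sqcup\!\sqcup\, r}$ is the $r$-fold shuffle power. Let $L(\,\cdot\,;z)$ be the $\mathbb Q$-linear map on the span of $1$ and the words beginning with $e_1$ with $L(e_1e_0^{k_1-1}\cdots e_1e_0^{k_n-1};z)=\mathrm{Li}_{k_1,\dots,k_n}(z)$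 and $L(1;z)=1$. For $\mathbf q,\mathbf r\in(\mathbb Z_{\ge0})^n$ let $n'$ be the number of leading zeros of $\mathbf r$, and split $\mathbf r=(\mathbf r',\mathbf r'')$, $\mathbf q=(\mathbf q',\mathbf q'')$ after the $n'$-th entry. Let $\overline{\mathbf q}=(|\mathbf q'|+n'+q''_1,q''_2,\dots)$ if $\mathbf q''\ne\emptyset$ and $\overline{\mathbf q}=\emptyset$ otherwise. Define $$f_{\mathbf q}^{\mathbf r}(\sigma)=B_{\mathbf q'}\sum_{\mathbf j\preceq\overline{\mathbf q}}C_{\overline{\mathbf q}}^{\mathbf j}\,(i\sigma)^{|\mathbf q|+n'-|\mathbf j|}\,L(w_{\mathbf j}^{\mathbf r''};e^{i\sigma})$$ and, for $n\ge1$, $$F_{\mathbf q}^{\mathbf r}(\sigma)=\sum(-1)^{h-1}\Big(\prod_{j=1}^{h-1}f_{\mathbf q^{(j)}}^{\mathbf r^{(j)}}(0)\Big)\Big(f_{\mathbf q^{(h)}}^{\mathbf r^{(h)}}(\sigma)-f_{\mathbf q^{(h)}}^{\mathbf r^{(h)}}(0)\Big),$$ the sum being over all ways to cut $\mathbf q$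 and $\mathbf r$ at the same places into $h\ge1$ consecutive nonempty blocks $\mathbf q=(\mathbf q^{(1)},\dots,\mathbf q^{(h)})$, $\mathbf r=(\mathbf r^{(1)},\dots,\mathbf r^{(h)})$; put $F_\emptyset^\emptyset(\sigma)=1$. \textbf{Theorem.} Let $n\ge0$, $\mathbf k\in\mathbb N^n$ and $\mathbf l\in(\mathbb Z_{\ge0})^n$ with $k_u-1-l_u\ge0$ for all $u$. For every $\sigma\in[0,2\pi]$ the integrand $\prod_{u}\theta_u^{l_u}A(\theta_u)^{k_u-1-l_u}$ is absolutely integrable on $\{0<\theta_1<\dots<\theta_n<\sigma\}$, and $$\mathrm{Ls}_{\mathbf k}^{\mathbf l}(\sigma)=i^{|\mathbf l|+n}(-1)^{|\mathbf k|+n}\sum_{\mathbf p+\mathbf q+\mathbf r=\mathbf k-\mathbf 1_n-\mathbf l}\frac{(-i\pi)^{|\mathbf p|}}{2^{|\mathbf p|+|\mathbf q|}}\left(\prod_{u=1}^n\frac{(k_u-1-l_u)!}{p_u!\,q_u!\,r_u!}\right)F_{\mathbf q+\mathbf l}^{\mathbf r}(\sigma),$$ the sum being over all $\mathbf p,\mathbf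 q,\mathbf r\in(\mathbb Z_{\ge0})^n$ with the stated sum. Moreover, for all $\mathbf q,\mathbf r\in(\mathbb Z_{\ge0})^n$, the function $F_{\mathbf q}^{\mathbf r}$ on $[0,2\pi]$ is a finite linear combination, with coefficients in $\mathbb Q(i)$ that do not depend on $\sigma$, of functions $\sigma\mapsto\sigma^a\,\zeta(\mathbf k^{(1)})\cdots\zeta(\mathbf k^{(s)})\,\mathrm{Li}_{\mathbf m}(e^{i\sigma})$ with $a,s\ge0$ and with $\mathbf k^{(1)},\dots,\mathbf k^{(s)},\mathbf m$ admissible. -/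

import Mathlib

namespace LogSine

noncomputable section

/-! ### Iterated log-sine integrals -/

/-- `A(θ) = log |2 sin (θ / 2)|`. -/
def A (θ : ℝ) : ℝ := Real.log |2 * Real.sin (θ / 2)|

/-- The iterated integral `∫_0^σ ∫_0^{θ_n} ⋯ ∫_0^{θ_2} g(θ_1, …, θ_n) dθ_1 ⋯ dθ_n`. -/
def iteratedIntegral : (n : ℕ) → ((Fin n → ℝ) → ℝ) → ℝ → ℝ
  | 0, g, _ => g Fin.elim0
  | n + 1, g, σ =>
      ∫ θ in (0 : ℝ)..σ, iteratedIntegral n (fun t => g (Fin.snoc (α := fun _ => ℝ) t θ)) θ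

/-- The integrand `∏_u θ_u ^ l_u * A(θ_u) ^ (k_u - 1 - l_u)`, with integer exponents. -/
def integrand {n : ℕ} (k l : Fin n → ℕ) (θ : Fin n → ℝ) : ℝ :=
  ∏ u, θ u ^ l u * A (θ u) ^ ((k u : ℤ) - 1 - (l u : ℤ))

/-- The iterated log-sine integral `Ls_k^l(σ)`. -/
def Ls {n : ℕ} (k l : Fin n → ℕ) (σ : ℝ) : ℝ :=
  (-1) ^ n * iteratedIntegral n (integrand k l) σ

/-- The domain `0 < θ_1 < ⋯ < θ_n < σ`. -/
def simplex (n : ℕ) (σ : ℝ) : Set (Fin n → ℝ) :=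
  {θ | StrictMono θ ∧ ∀ u, 0 < θ u ∧ θ u < σ}

/-! ### Multiple zeta values and multiple polylogarithms -/

/-- An index `(k_1, …, k_n)` is admissible if all entries are positive and `k_n ≥ 2`;
the empty index is admissible. -/
def Admissible (k : List ℕ) : Prop :=
  (∀ a ∈ k, 1 ≤ a) ∧ ∀ h : k ≠ [], 2 ≤ k.getLast h

/-- The tuples of integers `0 < m_1 < ⋯ < m_n`. -/
abbrev IncTuple (n : ℕ) : Type := {m : Fin n → ℕ // StrictMono m ∧ ∀ u, 0 < m u}

/-- The multiple zeta value `ζ(k)` for admissible `k` (it is `1` for the empty index). -/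
def mzv (k : List ℕ) : ℝ :=
  ∑' m : IncTuple k.length, 1 / ∏ u, (m.1 u : ℝ) ^ k.get u

/-- The multiple polylogarithm `Li_k(z) = ∑_{0 < m_1 < ⋯ < m_n} z ^ m_n / ∏ m_u ^ k_u`, as a
series. It is used only for admissible `k` and `|z| ≤ 1`, where the series converges absolutely. -/
def multiLi : List ℕ → ℂ → ℂ
  | [], _ => 1
  | a :: t, z => ∑' m : IncTuple (t.length + 1),
      z ^ m.1 (Fin.last t.length) / ∏ u, (m.1 u : ℂ) ^ (a :: t).get u

/-! ### Words and the shuffle product -/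

/-- The noncommutative polynomial ring `ℚ⟨e₀, e₁⟩`. -/
abbrev H : Type := FreeAlgebra ℚ (Fin 2)

/-- The letter `e_a`. -/
abbrev e (a : Fin 2) : H := FreeAlgebra.ι ℚ a

/-- The word `e_{a_1} ⋯ e_{a_s}` as an element of `H`. -/
def word (w : List (Fin 2)) : H := (w.map e).prod

/-- The basis of `H` that consists of the words. -/
def wordBasis : Module.Basis (FreeMonoid (Fin 2)) ℚ H := FreeAlgebra.basisFreeMonoid ℚ (Fin 2)

theorem wordBasis_apply (w : List (Fin 2)) : wordBasis (FreeMonoid.ofList w) = word w := by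
  simp [wordBasis, FreeAlgebra.basisFreeMonoid, word, FreeAlgebra.equivMonoidAlgebraFreeMonoid,
    FreeMonoid.lift_apply]

/-- The shuffle product of two words. -/
def shuffleWord : List (Fin 2) → List (Fin 2) → H
  | w, [] => word w
  | [], w => word w
  | a :: u, b :: v => e a * shuffleWord u (b :: v) + e b * shuffleWord (a :: u) v
termination_by u v => u.length + v.length

/-- The shuffle product on `H`, extended bilinearly from words. -/
def shuffle : H →ₗ[ℚ] H →ₗ[ℚ] H :=
  wordBasis.constr ℚ fun u => wordBasis.constr ℚ fun v => shuffleWord u.toList v.toList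

/-- The shuffle power `x ⧢ ⋯ ⧢ x` with `r` factors. -/
def shufflePow (x : H) : ℕ → H
  | 0 => 1
  | r + 1 => shuffle (shufflePow x r) x

/-- For a word `e₀^c e₁ e₀^(k_1 - 1) ⋯ e₁ e₀^(k_n - 1)`, the pair `(c, (k_1, …, k_n))`. -/
def decode : List (Fin 2) → ℕ × List ℕ
  | [] => (0, [])
  | a :: w => if a = 0 then ((decode w).1 + 1, (decode w).2) else (0, ((decode w).1 + 1) :: (decode w).2)

/-- The word `e₁ e₀^(k_1 - 1) ⋯ e₁ e₀^(k_n - 1)`. -/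
def encode (k : List ℕ) : List (Fin 2) := k.flatMap fun a => 1 :: List.replicate (a - 1) 0

theorem decode_replicate (c : ℕ) (w : List (Fin 2)) :
    decode (List.replicate c 0 ++ w) = ((decode w).1 + c, (decode w).2) := by
  induction c with
  | zero => simp
  | succ c ih => simp [List.replicate_succ, decode, ih]; omega

theorem decode_encode (k : List ℕ) (hk : ∀ a ∈ k, 1 ≤ a) : decode (encode k) = (0, k) := by
  induction k with
  | nil => rfl
  | cons a k ih =>
    have ha : 1 ≤ a := hk a (by simp)
    have ih' := ih fun b hb => hk b (by simp [hb])
    have : encode (a :: k) = 1 :: (List.replicate (a - 1) 0 ++ encode k) := by simp [encode]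
    rw [this, decode, decode_replicate, ih']
    simp
    omega

/-- The `ℚ`-linear map `L(·; z)` with `L(e₁ e₀^(k_1 - 1) ⋯ e₁ e₀^(k_n - 1); z) = Li_k(z)`, `L(1; z) = 1`.
Its domain is the span of `1` and of the words that begin with `e₁`; it is extended by zero to
the words that begin with `e₀`, to which it is never applied below. -/
def L (z : ℂ) : H →ₗ[ℚ] ℂ :=
  wordBasis.constr ℚ fun w =>
    if (decode w.toList).1 = 0 then multiLi (decode w.toList).2 z else 0

theorem L_word_encode (z : ℂ) (k : List ℕ) (hk : ∀ a ∈ k, 1 ≤ a) :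
    L z (word (encode k)) = multiLi k z := by
  rw [← wordBasis_apply, L, Module.Basis.constr_basis]
  simp [decode_encode k hk]

/-! ### The functions `f` and `F`

Indices are lists; `k.sum`, `k.length`, `k.dropLast` are the weight `|k|`, the depth and `k₋`. -/

/-- `B_q = B_{q₋} / (|q| + n)`, `B_∅ = 1`. -/
def B (q : List ℕ) : ℚ :=
  if _h : q = [] then 1 else 1 / ((q.sum : ℚ) + q.length) * B q.dropLast
termination_by q.length
decreasing_by have := List.length_pos_iff.2 _h; simp; omega

/-- `C_q^j = (-1)^{j_n} (|q| - |j₋|)! / (|q| - |j|)! * C_{q₋}^{j₋}`, `C_∅^∅ = 1`. It is used only for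
`j ≼ q`, where both differences are nonnegative. -/
def C (q j : List ℕ) : ℚ :=
  if _h : q = [] then 1
  else (-1) ^ j.getLastD 0 * (((q.sum - j.dropLast.sum).factorial : ℚ) / (q.sum - j.sum).factorial)
    * C q.dropLast j.dropLast
termination_by q.length
decreasing_by have := List.length_pos_iff.2 _h; simp; omega

/-- `j ≼ q`: all partial sums of `j` are at most those of `q`. -/
def Prec (j q : List ℕ) : Prop := ∀ m ≤ q.length, (j.take m).sum ≤ (q.take m).sum

open Classical in
/-- The finite set of all `j ∈ (ℤ_{≥ 0})^n` with `j ≼ q`, where `n` is the depth of `q`. -/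
def precFinset (q : List ℕ) : Finset (List ℕ) :=
  ((Fintype.piFinset fun _ : Fin q.length => Finset.range (q.sum + 1)).image List.ofFn).filter
    fun j => Prec j q

theorem mem_precFinset {q j : List ℕ} : j ∈ precFinset q ↔ j.length = q.length ∧ Prec j q := by
  simp only [precFinset, Finset.mem_filter, Finset.mem_image, Fintype.mem_piFinset,
    Finset.mem_range]
  constructor
  · rintro ⟨⟨v, -, rfl⟩, h⟩
    exact ⟨by simp, h⟩
  · rintro ⟨hl, h⟩
    refine ⟨⟨fun u => j.get (u.cast hl.symm), fun u => ?_, ?_⟩, h⟩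
    · have h1 : j.get (u.cast hl.symm) ≤ j.sum := List.le_sum_of_mem (List.get_mem _ _)
      have h2 := h q.length le_rfl
      rw [← hl, List.take_length, hl, List.take_length] at h2
      exact Nat.lt_succ_of_le (h1.trans h2)
    · apply List.ext_get <;> simp [hl]

/-- `w_j^r = (w_{j₋}^{r₋} ⧢ e₁^{⧢ r_n}) e₀^{1 + j_n}`, `w_∅^∅ = 1`. -/
def w (j r : List ℕ) : H :=
  if _h : r = [] then 1
  else shuffle (w j.dropLast r.dropLast) (shufflePow (e 1) (r.getLastD 0)) * e 0 ^ (1 + j.getLastD 0)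
termination_by r.length
decreasing_by have := List.length_pos_iff.2 _h; simp; omega

/-- The number `n'` of leading zeros of `r`. Then `r' = r.take n'`, `r'' = r.drop n'`,
`q' = q.take n'` and `q'' = q.drop n'`. -/
def leadingZeros (r : List ℕ) : ℕ := (r.takeWhile (· = 0)).length

/-- `q̄ = (|q'| + n' + q''_1, q''_2, …, q''_{n''})` if `q'' ≠ ∅`, and `∅` otherwise. -/
def bar (n' : ℕ) (q : List ℕ) : List ℕ :=
  match q.drop n' with
  | [] => []
  | a :: t => ((q.take n').sum + n' + a) :: t

/-- `f_q^r(σ) = B_{q'} ∑_{j ≼ q̄} C_{q̄}^j (iσ)^{|q| + n' - |j|} L(w_j^{r''}; e^{iσ})`. -/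
def f (q r : List ℕ) (σ : ℝ) : ℂ :=
  let n' := leadingZeros r
  (B (q.take n') : ℂ) * ∑ j ∈ precFinset (bar n' q),
    (C (bar n' q) j : ℂ) * (Complex.I * σ) ^ (q.sum + n' - j.sum)
      * L (Complex.exp (Complex.I * σ)) (w j (r.drop n'))

/-- `F_q^r(σ) = ∑ (-1)^{h-1} (∏_{j<h} f_{q^{(j)}}^{r^{(j)}}(0)) (f_{q^{(h)}}^{r^{(h)}}(σ) - f_{q^{(h)}}^{r^{(h)}}(0))`,
the sum being over all ways to cut `q` and `r` simultaneously into `h` consecutive nonempty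
blocks `q^{(1)}, …, q^{(h)}` and `r^{(1)}, …, r^{(h)}`; and `F_∅^∅ = 1`. In the code the blocks are numbered
from `0` to `h - 1`. -/
def F (q r : List ℕ) (σ : ℝ) : ℂ :=
  if q = [] then 1
  else ∑ c : Composition q.length,
    let h := c.length
    let Q : ℕ → List ℕ := fun j => (q.splitWrtComposition c).getD j []
    let R : ℕ → List ℕ := fun j => (r.splitWrtComposition c).getD j []
    (-1) ^ (h - 1) * (∏ j ∈ Finset.range (h - 1), f (Q j) (R j) 0)
      * (f (Q (h - 1)) (R (h - 1)) σ - f (Q (h - 1)) (R (h - 1)) 0)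

/-! ### Linear combinations over `ℚ(i)` -/

/-- The field `ℚ(i)`. -/
abbrev QI : IntermediateField ℚ ℂ := IntermediateField.adjoin ℚ {Complex.I}

/-- The functions `σ ↦ σ^a ζ(k^{(1)}) ⋯ ζ(k^{(s)}) Li_m(e^{iσ})` on `[0, 2π]`, with `a ≥ 0`, `s ≥ 0` and with
admissible indices `k^{(1)}, …, k^{(s)}, m`. -/
def elementaryProducts : Set (Set.Icc (0 : ℝ) (2 * Real.pi) → ℂ) :=
  {g | ∃ (a : ℕ) (ks : List (List ℕ)) (m : List ℕ),
    (∀ k ∈ ks, Admissible k) ∧ Admissible m ∧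
    g = fun σ : Set.Icc (0 : ℝ) (2 * Real.pi) => ((σ : ℝ) : ℂ) ^ a * (ks.map fun k => (mzv k : ℂ)).prod
      * multiLi m (Complex.exp (Complex.I * ((σ : ℝ) : ℂ)))}

end

end LogSine

/-!
On `(0, 2π)` one has `A(θ) = -(Li₁(e^{iθ}) + iθ/2 - iπ/2)` with `Li₁(z) = -log (1 - z)`. Expanding the
powers of `A` by the trinomial theorem reduces the log-sine integral to the iterated integrals of
the forms `φ = (iθ)^q Li₁(e^{iθ})^r i dθ`, and the claim becomes that `F_q^r` is the iterated integral of
these forms from `0` to `σ` (`F_eq_iterInt`).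

Formally, `f_q^r` is a primitive of `φ_{q_n}^{r_n} f_{q₋}^{r₋}`: appending `e₀` to a word integrates its
polylogarithm against `dz/z = i dσ`, so that the sum over `j_n` in `f` is a repeated integration by
parts (`hasDerivAt_byParts`), and the shuffle product with `e₁^{⧢ r}` is multiplication by `Li₁^r`
(`polylog_shuffle`). The alternating sum over cuts that defines `F` corrects the constants of
integration. Splitting off the first block of the cuts turns this into an induction on the depth
(`F_eq_sub_sum`, `F_concat_eq_integral`).

On the unit circle the polylogarithms of words that end in `e₁` do not converge absolutely. The
differential equation is therefore proved on the circles of radius `ρ < 1` (`hasDerivAt_fReg`), where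
all series converge, and its integrated form passes to the limit `ρ → 1` (`f_sub_eq_integral`): the
words that occur in `f` are admissible, so their series are continuous on the closed disc, and
`|log (1 - ρ e^{iθ})| ≤ |A(θ)| + 6` gives an integrable bound, all powers of `A` being integrable.

The multiplicativity for shuffle products is an identity of formal power series, proved by induction
from the Euler operator `X d/dX`, which strips the last letter of a word (`liLin_shuffleWord`).
Absolute convergence for admissible words follows from the bound `O(m^{-1/2})` on the coefficients
of nonempty words (`exists_coeff_liSeries_le`). Finally `F` lies in the span of the elementary products
because the values `f(0)` are polynomials in multiple zeta values over `ℚ` (`isMultiplier_f_zero`).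
-/

namespace LogSine

noncomputable section

section

open PowerSeries

/-! ### The shuffle product on words -/

theorem word_nil : word [] = 1 := by simp [word]

theorem word_append (u v : List (Fin 2)) : word (u ++ v) = word u * word v := by simp [word]

theorem word_singleton (a : Fin 2) : word [a] = e a := by simp [word]

theorem word_cons (a : Fin 2) (u : List (Fin 2)) : word (a :: u) = e a * word u := by simp [word]

theorem shuffleWord_nil_right (u : List (Fin 2)) : shuffleWord u [] = word u := by
  cases u <;> simp [shuffleWord]

theorem shuffleWord_nil_left (u : List (Fin 2)) : shuffleWord [] u = word u := by
  cases u <;> simp [shuffleWord]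

theorem shuffleWord_cons_cons (a b : Fin 2) (u v : List (Fin 2)) :
    shuffleWord (a :: u) (b :: v) =
      e a * shuffleWord u (b :: v) + e b * shuffleWord (a :: u) v := by
  rw [shuffleWord]

/-- The shuffle product, defined by splitting off first letters, can also be computed by splitting
off last letters. Only the latter recursion interacts well with differentiation. -/
theorem shuffleWord_concat_concat (u v : List (Fin 2)) (a b : Fin 2) :
    shuffleWord (u ++ [a]) (v ++ [b]) =
      shuffleWord u (v ++ [b]) * e a + shuffleWord (u ++ [a]) v * e b := by
  induction h : u.length + v.length using Nat.strong_induction_on generalizing u v with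
  | _ n ih =>
    subst h
    rcases u with _ | ⟨c, u⟩ <;> rcases v with _ | ⟨d, v⟩
    · simp only [List.nil_append, shuffleWord_cons_cons, shuffleWord_nil_left,
        shuffleWord_nil_right, word_singleton]
      abel
    · have h1 := ih (0 + v.length) (by simp) [] v (by simp)
      simp only [List.nil_append, List.cons_append, shuffleWord_cons_cons, shuffleWord_nil_left]
        at h1 ⊢
      rw [h1]
      simp only [word_cons, word_append, word_nil, mul_one, mul_add, add_mul, mul_assoc]
      abel
    · have h1 := ih (u.length + 0) (by simp) u [] (by simp)
      simp only [List.nil_append, List.cons_append, shuffleWord_cons_cons, shuffleWord_nil_right]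
        at h1 ⊢
      rw [h1]
      simp only [word_cons, word_append, word_nil, mul_one, mul_add, add_mul, mul_assoc]
      abel
    · have h1 := ih (u.length + (v.length + 1)) (by simp) u (d :: v) (by simp)
      have h2 := ih (u.length + 1 + v.length) (by simp) (c :: u) v (by simp)
      simp only [List.cons_append, shuffleWord_cons_cons] at h1 h2 ⊢
      rw [h1, h2]
      simp only [mul_add, add_mul, mul_assoc]
      abel

theorem shuffle_word (u v : List (Fin 2)) : shuffle (word u) (word v) = shuffleWord u v := by
  rw [shuffle, ← wordBasis_apply u, ← wordBasis_apply v, Module.Basis.constr_basis,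
    Module.Basis.constr_basis]
  rfl

theorem word_induction {p : H → Prop} (hw : ∀ w, p (word w)) (h0 : p 0)
    (hadd : ∀ x y, p x → p y → p (x + y)) (hsmul : ∀ (c : ℚ) x, p x → p (c • x)) (x : H) : p x := by
  have hx : x ∈ Submodule.span ℚ (Set.range wordBasis) := by
    rw [wordBasis.span_eq]; trivial
  induction hx using Submodule.span_induction with
  | mem x hx =>
    obtain ⟨w, rfl⟩ := hx
    have := hw w.toList
    rwa [← wordBasis_apply] at this
  | zero => exact h0
  | add x y _ _ hx hy => exact hadd x y hx hy
  | smul c x _ hx => exact hsmul c x hx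

theorem hom_ext_word {M : Type*} [AddCommGroup M] [Module ℚ M] {g h : H →ₗ[ℚ] M}
    (hgh : ∀ w, g (word w) = h (word w)) : g = h :=
  wordBasis.ext fun w => by
    have := hgh w.toList
    rwa [← wordBasis_apply] at this

/-! ### Generating series of multiple polylogarithms -/

/-- The Euler operator `X * d/dX` on formal power series. -/
def euler (s : PowerSeries ℝ) : PowerSeries ℝ := mk fun m => m * coeff m s

theorem euler_mul (s t : PowerSeries ℝ) : euler (s * t) = euler s * t + s * euler t := by
  ext m
  simp only [euler, coeff_mk, coeff_mul, map_add, Finset.mul_sum, ← Finset.sum_add_distrib]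
  refine Finset.sum_congr rfl fun x hx => ?_
  rw [← Finset.HasAntidiagonal.mem_antidiagonal.1 hx]
  push_cast
  ring

theorem euler_add (s t : PowerSeries ℝ) : euler (s + t) = euler s + euler t := by
  ext m
  simp [euler, mul_add]

theorem eq_of_euler_eq {s t : PowerSeries ℝ} (h : euler s = euler t)
    (h0 : coeff 0 s = coeff 0 t) : s = t := by
  ext m
  rcases Nat.eq_zero_or_pos m with rfl | hm
  · exact h0
  · have := congrArg (coeff m) h
    simp only [euler, coeff_mk] at this
    exact mul_left_cancel₀ (by positivity) this

/-- Integration against `dX / X` (letter `e₀`) or `dX / (1 - X)` (letter `e₁`). The constant term is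
killed, as division by `m = 0` gives `0`. -/
def letterOp (a : Fin 2) : PowerSeries ℝ →ₗ[ℝ] PowerSeries ℝ where
  toFun s := if a = 0 then mk fun m => coeff m s / m
    else mk fun m => (∑ j ∈ Finset.range m, coeff j s) / m
  map_add' s t := by
    split_ifs <;> ext m <;> simp [Finset.sum_add_distrib, add_div]
  map_smul' c s := by
    split_ifs <;> ext m <;> simp [← Finset.mul_sum, mul_div_assoc]

theorem coeff_letterOp_zero (m : ℕ) (s : PowerSeries ℝ) :
    coeff m (letterOp 0 s) = coeff m s / m := by
  simp [letterOp]

theorem coeff_letterOp_one (m : ℕ) (s : PowerSeries ℝ) :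
    coeff m (letterOp 1 s) = (∑ j ∈ Finset.range m, coeff j s) / m := by
  simp [letterOp]

theorem coeff_zero_letterOp (a : Fin 2) (s : PowerSeries ℝ) : coeff 0 (letterOp a s) = 0 := by
  fin_cases a
  · exact (coeff_letterOp_zero _ _).trans (by simp)
  · exact (coeff_letterOp_one _ _).trans (by simp)

/-- The factor in `X d/dX (letterOp a s) = s * letterForm a`: `1` for `e₀` (if `s` has no constant term),
and `X / (1 - X)` for `e₁`. -/
def letterForm (a : Fin 2) : PowerSeries ℝ := if a = 0 then 1 else mk fun m => if m = 0 then 0 else 1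

theorem euler_letterOp {a : Fin 2} {s : PowerSeries ℝ} (h : a = 0 → coeff 0 s = 0) :
    euler (letterOp a s) = s * letterForm a := by
  ext m
  fin_cases a
  · rcases Nat.eq_zero_or_pos m with rfl | hm
    · simpa [euler, letterForm] using (h rfl).symm
    · have : (m : ℝ) ≠ 0 := by positivity
      simp [euler, letterForm, coeff_letterOp_zero]
      field_simp
  · have h1 : coeff m (s * letterForm 1) = ∑ j ∈ Finset.range m, coeff j s := by
      rw [coeff_mul, Finset.Nat.sum_antidiagonal_eq_sum_range_succ_mk, Finset.sum_range_succ]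
      simp only [letterForm]
      simp only [one_ne_zero, if_false, coeff_mk, Nat.sub_self, if_true, mul_zero, add_zero]
      refine Finset.sum_congr rfl fun j hj => ?_
      rw [if_neg (by have := Finset.mem_range.1 hj; omega), mul_one]
    change coeff m (euler (letterOp 1 s)) = coeff m (s * letterForm 1)
    rw [h1, euler, coeff_mk, coeff_letterOp_one]
    rcases Nat.eq_zero_or_pos m with rfl | hm
    · simp
    · field_simp

/-- The power series `∑ z ^ m_n / ∏ m_u ^ k_u` attached to the word `e₁ e₀^(k_1 - 1) ⋯ e₁ e₀^(k_n - 1)`,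
built letter by letter. It is `0` for words that begin with `e₀`. -/
def liSeries (w : List (Fin 2)) : PowerSeries ℝ := w.foldl (fun s a => letterOp a s) 1

theorem liSeries_nil : liSeries [] = 1 := rfl

theorem liSeries_concat (w : List (Fin 2)) (a : Fin 2) :
    liSeries (w ++ [a]) = letterOp a (liSeries w) := by
  simp [liSeries]

theorem coeff_zero_liSeries {w : List (Fin 2)} (hw : w ≠ []) : coeff 0 (liSeries w) = 0 := by
  rw [← List.dropLast_append_getLast hw, liSeries_concat, coeff_zero_letterOp]

/-- The linear extension of `liSeries` to `H`. -/
def liLin : H →ₗ[ℚ] PowerSeries ℝ := wordBasis.constr ℚ fun w => liSeries w.toList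

theorem liLin_word (w : List (Fin 2)) : liLin (word w) = liSeries w := by
  rw [liLin, ← wordBasis_apply, Module.Basis.constr_basis]
  rfl

theorem liLin_mul_e (x : H) (a : Fin 2) : liLin (x * e a) = letterOp a (liLin x) := by
  have : liLin ∘ₗ LinearMap.mulRight ℚ (e a) = (letterOp a).restrictScalars ℚ ∘ₗ liLin := by
    refine hom_ext_word fun w => ?_
    simp only [LinearMap.comp_apply, LinearMap.mulRight_apply, LinearMap.coe_restrictScalars]
    rw [← word_singleton, ← word_append, liLin_word, liLin_word, liSeries_concat]
  exact LinearMap.congr_fun this x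

/-- The words that do not begin with `e₀`. -/
def Proper (w : List (Fin 2)) : Prop := ∀ a ∈ w.head?, a = 1

theorem Proper.of_concat {w : List (Fin 2)} {a : Fin 2} (h : Proper (w ++ [a])) : Proper w := by
  cases w <;> simp_all [Proper]

theorem Proper.euler_liSeries {w : List (Fin 2)} {a : Fin 2} (h : Proper (w ++ [a])) :
    euler (liSeries (w ++ [a])) = liSeries w * letterForm a := by
  rw [liSeries_concat]
  refine euler_letterOp fun ha => coeff_zero_liSeries ?_
  rintro rfl
  simp_all [Proper]

/-- The generating series turn shuffle products into products: both sides have the same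
Euler derivative by induction, and the same constant term. -/
theorem liLin_shuffleWord (u v : List (Fin 2)) (hu : Proper u) (hv : Proper v) :
    liLin (shuffleWord u v) = liSeries u * liSeries v := by
  induction h : u.length + v.length using Nat.strong_induction_on generalizing u v with
  | _ n ih =>
    subst h
    rcases List.eq_nil_or_concat' u with rfl | ⟨u, a, rfl⟩
    · rw [shuffleWord_nil_left, liLin_word, liSeries_nil, one_mul]
    rcases List.eq_nil_or_concat' v with rfl | ⟨v, b, rfl⟩
    · rw [shuffleWord_nil_right, liLin_word, liSeries_nil, mul_one]
    have h1 := ih _ (by simp) u (v ++ [b]) hu.of_concat hv rfl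
    have h2 := ih _ (by simp) (u ++ [a]) v hu hv.of_concat rfl
    have hu0 : coeff 0 (liSeries (u ++ [a])) = 0 := coeff_zero_liSeries (by simp)
    have hv0 : coeff 0 (liSeries (v ++ [b])) = 0 := coeff_zero_liSeries (by simp)
    rw [shuffleWord_concat_concat, map_add, liLin_mul_e, liLin_mul_e, h1, h2]
    apply eq_of_euler_eq
    · rw [euler_add, euler_letterOp, euler_letterOp, euler_mul, hu.euler_liSeries,
        hv.euler_liSeries]
      · ring
      · intro _; simpa using Or.inl hu0
      · intro _; simpa using Or.inr hv0
    · simp only [map_add, coeff_zero_letterOp]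
      simpa using Or.inl hu0

/-- The span of the proper words. -/
def properSpan : Submodule ℚ H := Submodule.span ℚ (word '' {w | Proper w})

theorem liLin_shuffle {x y : H} (hx : x ∈ properSpan) (hy : y ∈ properSpan) :
    liLin (shuffle x y) = liLin x * liLin y := by
  induction hx, hy using Submodule.span_induction₂ with
  | mem_mem x y hx hy =>
    obtain ⟨u, hu, rfl⟩ := hx
    obtain ⟨v, hv, rfl⟩ := hy
    rw [shuffle_word, liLin_shuffleWord u v hu hv, liLin_word, liLin_word]
  | zero_left y hy => simp
  | zero_right x hx => simp
  | add_left x y z _ _ _ h1 h2 => simp [h1, h2, add_mul]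
  | add_right x y z _ _ _ h1 h2 => simp [h1, h2, mul_add]
  | smul_left r x y _ _ h => simp [h]
  | smul_right r x y _ _ h => simp [h]

/-! ### Size of the coefficients -/

theorem coeff_liSeries_nonneg (w : List (Fin 2)) (m : ℕ) : 0 ≤ coeff m (liSeries w) := by
  induction w using List.reverseRecOn generalizing m with
  | nil => rw [liSeries_nil, coeff_one]; split_ifs <;> norm_num
  | append_singleton w a ih =>
    rw [liSeries_concat]
    fin_cases a
    · exact (coeff_letterOp_zero m _).symm ▸ div_nonneg (ih m) (by positivity)
    · exact (coeff_letterOp_one m _).symm ▸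
        div_nonneg (Finset.sum_nonneg fun j _ => ih j) (by positivity)

theorem coeff_liSeries_le_one (w : List (Fin 2)) (m : ℕ) : coeff m (liSeries w) ≤ 1 := by
  induction w using List.reverseRecOn generalizing m with
  | nil => rw [liSeries_nil, coeff_one]; split_ifs <;> norm_num
  | append_singleton w a ih =>
    rw [liSeries_concat]
    rcases Nat.eq_zero_or_pos m with rfl | hm
    · rw [coeff_zero_letterOp]; exact zero_le_one
    fin_cases a
    · refine (coeff_letterOp_zero m _).trans_le (div_le_one_of_le₀ ?_ (by positivity))
      exact (ih m).trans (by exact_mod_cast hm)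
    · refine (coeff_letterOp_one m _).trans_le (div_le_one_of_le₀ ?_ (by positivity))
      exact (Finset.sum_le_sum fun j _ => ih j).trans (by simp)

theorem sum_inv_sqrt_le (m : ℕ) : ∑ j ∈ Finset.range (m + 1), 1 / √(j : ℝ) ≤ 2 * √m := by
  induction m with
  | zero => simp
  | succ m ih =>
    rw [Finset.sum_range_succ]
    have h1 : 0 < √((m + 1 : ℕ) : ℝ) := Real.sqrt_pos.2 (by positivity)
    have h0 : 0 ≤ √(m : ℝ) := Real.sqrt_nonneg _
    have h2 : √((m + 1 : ℕ) : ℝ) ^ 2 = m + 1 := by rw [Real.sq_sqrt (by positivity)]; push_cast; rfl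
    have h3 : √(m : ℝ) ^ 2 = m := Real.sq_sqrt (by positivity)
    have : 1 / √((m + 1 : ℕ) : ℝ) ≤ 2 * √((m + 1 : ℕ) : ℝ) - 2 * √(m : ℝ) := by
      rw [div_le_iff₀ h1]
      nlinarith [sq_nonneg (√((m + 1 : ℕ) : ℝ) - √(m : ℝ))]
    linarith

/-- Each integration divides by `m`, and each summation costs at most a factor `2 √m`. -/
theorem exists_coeff_liSeries_le {w : List (Fin 2)} (hw : w ≠ []) :
    ∃ c : ℝ, 0 ≤ c ∧ ∀ m, coeff m (liSeries w) ≤ c / √(m : ℝ) := by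
  induction w using List.reverseRecOn with
  | nil => exact absurd rfl hw
  | append_singleton w a ih =>
    -- a bound that holds for the empty word as well, where the only coefficient is at `m = 0`
    have key : ∃ c : ℝ, 0 ≤ c ∧ ∀ m, coeff m (liSeries w) ≤ (if m = 0 then c else c / √(m : ℝ)) := by
      rcases eq_or_ne w [] with rfl | hw'
      · refine ⟨1, zero_le_one, fun m => ?_⟩
        rw [liSeries_nil, coeff_one]
        split_ifs
        · exact le_rfl
        · positivity
      · obtain ⟨c, hc, h⟩ := ih hw'
        refine ⟨c, hc, fun m => ?_⟩
        split_ifs with hm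
        · subst hm; rw [coeff_zero_liSeries hw']; exact hc
        · exact h m
    obtain ⟨c, hc, h⟩ := key
    rw [liSeries_concat]
    have hsum : ∀ m, 0 < m → ∑ j ∈ Finset.range m, coeff j (liSeries w) ≤ 3 * c * √(m : ℝ) := by
      rintro (_ | m) hm
      · simp at hm
      have h1 : ∑ j ∈ Finset.range (m + 1), coeff j (liSeries w) ≤
          c + c * ∑ j ∈ Finset.range (m + 1), 1 / √(j : ℝ) := by
        rw [Finset.sum_range_succ', Finset.sum_range_succ']
        have h2 : coeff 0 (liSeries w) ≤ c := by simpa using h 0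
        have h3 : ∑ j ∈ Finset.range m, coeff (j + 1) (liSeries w) ≤
            c * ∑ j ∈ Finset.range m, 1 / √((j + 1 : ℕ) : ℝ) := by
          rw [Finset.mul_sum]
          refine Finset.sum_le_sum fun j _ => (h (j + 1)).trans_eq ?_
          simp [div_eq_mul_inv]
        simp only [Nat.cast_zero, Real.sqrt_zero, div_zero, add_zero]
        linarith
      have h4 : √(m : ℝ) ≤ √((m + 1 : ℕ) : ℝ) := Real.sqrt_le_sqrt (by push_cast; linarith)
      have h5 : 1 ≤ √((m + 1 : ℕ) : ℝ) := Real.one_le_sqrt.2 (by push_cast; linarith [m.cast_nonneg (α := ℝ)])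
      nlinarith [sum_inv_sqrt_le m, mul_le_mul_of_nonneg_left (sum_inv_sqrt_le m) hc,
        mul_le_mul_of_nonneg_left h4 hc, mul_le_mul_of_nonneg_left h5 hc]
    refine ⟨3 * c, by positivity, fun m => ?_⟩
    rcases Nat.eq_zero_or_pos m with rfl | hm
    · rw [coeff_zero_letterOp]; simp
    have hm' : (0 : ℝ) < m := by exact_mod_cast hm
    fin_cases a
    · refine (coeff_letterOp_zero m _).trans_le ?_
      have h1 := h m
      rw [if_neg hm.ne'] at h1
      have h2 : coeff m (liSeries w) / m ≤ coeff m (liSeries w) :=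
        div_le_self (coeff_liSeries_nonneg w m) (by exact_mod_cast hm)
      refine h2.trans (h1.trans ?_)
      gcongr
      linarith
    · refine (coeff_letterOp_one m _).trans_le ?_
      rw [div_le_div_iff₀ hm' (Real.sqrt_pos.2 hm')]
      calc _ ≤ 3 * c * √(m : ℝ) * √(m : ℝ) := by
            gcongr
            exact hsum m hm
        _ = _ := by rw [mul_assoc, Real.mul_self_sqrt hm'.le]

theorem summable_coeff_liSeries_concat_zero (w : List (Fin 2)) :
    Summable fun m => coeff m (liSeries (w ++ [0])) := by
  rcases eq_or_ne w [] with rfl | hw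
  · refine summable_zero.congr fun m => ?_
    rw [liSeries_concat, coeff_letterOp_zero, liSeries_nil, coeff_one]
    split_ifs with hm <;> simp [hm]
  · obtain ⟨c, hc, h⟩ := exists_coeff_liSeries_le hw
    refine Summable.of_nonneg_of_le (fun m => coeff_liSeries_nonneg _ m) (fun m => ?_)
      ((Real.summable_one_div_nat_rpow.2 (by norm_num : (1 : ℝ) < 3 / 2)).mul_left c)
    rw [liSeries_concat, coeff_letterOp_zero]
    rcases Nat.eq_zero_or_pos m with rfl | hm
    · simp
    have hm' : (0 : ℝ) < m := by exact_mod_cast hm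
    have : (m : ℝ) ^ (3 / 2 : ℝ) = √(m : ℝ) * m := by
      rw [Real.sqrt_eq_rpow, ← Real.rpow_add_one hm'.ne']; norm_num
    rw [this, mul_one_div, ← div_div]
    gcongr
    exact h m

/-! ### Nested sums as coefficients -/

/-- The increasing tuples of positive integers below `m`. -/
def incTuplesBelow (n m : ℕ) : Finset (Fin n → ℕ) :=
  (Fintype.piFinset fun _ => Finset.range m).filter fun t => StrictMono t ∧ ∀ u, 0 < t u

theorem mem_incTuplesBelow {n m : ℕ} {t : Fin n → ℕ} :
    t ∈ incTuplesBelow n m ↔ (StrictMono t ∧ ∀ u, 0 < t u) ∧ ∀ u, t u < m := by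
  simp [incTuplesBelow, and_comm]

theorem strictMono_snoc_iff {n : ℕ} {α : Type*} [Preorder α] {t : Fin n → α} {j : α} :
    StrictMono (Fin.snoc (α := fun _ => α) t j) ↔ StrictMono t ∧ ∀ u, t u < j := by
  constructor
  · intro h
    refine ⟨fun a b hab => ?_, fun u => ?_⟩
    · simpa using h (Fin.castSucc_lt_castSucc_iff.2 hab)
    · simpa using h (Fin.castSucc_lt_last u)
  · rintro ⟨h1, h2⟩ a b hab
    induction b using Fin.lastCases with
    | last =>
      induction a using Fin.lastCases with
      | last => exact absurd hab (lt_irrefl _)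
      | cast a => simpa using h2 a
    | cast b =>
      induction a using Fin.lastCases with
      | last => exact absurd hab (not_lt.2 (Fin.le_last _))
      | cast a => simpa using h1 (Fin.castSucc_lt_castSucc_iff.1 hab)

theorem snoc_inc_iff {n : ℕ} {t : Fin n → ℕ} {j : ℕ} :
    (StrictMono (Fin.snoc (α := fun _ => ℕ) t j) ∧
      ∀ u, 0 < Fin.snoc (α := fun _ => ℕ) t j u) ↔ 0 < j ∧ t ∈ incTuplesBelow n j := by
  rw [mem_incTuplesBelow, strictMono_snoc_iff, Fin.forall_fin_succ']
  simp only [Fin.snoc_castSucc, Fin.snoc_last]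
  tauto

/-- The increasing tuples of positive integers below `j`, with no tuple at all for `j = 0`: the
initial parts of the increasing tuples whose last entry is `j`. -/
def incInits (n j : ℕ) : Finset (Fin n → ℕ) := if 0 < j then incTuplesBelow n j else ∅

theorem mem_incInits {n j : ℕ} {t : Fin n → ℕ} :
    t ∈ incInits n j ↔ 0 < j ∧ t ∈ incTuplesBelow n j := by
  unfold incInits; split_ifs with h <;> simp [h]

theorem sum_incTuplesBelow_succ {n m : ℕ} (g : (Fin (n + 1) → ℕ) → ℝ) :
    ∑ t ∈ incTuplesBelow (n + 1) m, g t =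
      ∑ j ∈ Finset.range m, ∑ t ∈ incInits n j, g (Fin.snoc (α := fun _ => ℕ) t j) := by
  rw [Finset.sum_sigma']
  refine Finset.sum_bij' (fun t _ => ⟨t (Fin.last n), Fin.init t⟩)
    (fun x _ => Fin.snoc (α := fun _ => ℕ) x.2 x.1) ?_ ?_ ?_ ?_ ?_
  · intro t ht
    have h := mem_incTuplesBelow.1 ht
    have h1 := h.1
    rw [← Fin.snoc_init_self t] at h1
    rw [Finset.mem_sigma, Finset.mem_range, mem_incInits]
    exact ⟨h.2 _, snoc_inc_iff.1 h1⟩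
  · rintro ⟨j, t⟩ h
    rw [Finset.mem_sigma, Finset.mem_range, mem_incInits] at h
    refine mem_incTuplesBelow.2 ⟨snoc_inc_iff.2 h.2, Fin.forall_fin_succ'.2 ⟨fun u => ?_, ?_⟩⟩
    · simpa using ((mem_incTuplesBelow.1 h.2.2).2 u).trans h.1
    · simpa using h.1
  · intro t _
    exact Fin.snoc_init_self t
  · rintro ⟨j, t⟩ _
    simp
  · intro t _
    simp only [Fin.snoc_init_self]

theorem encode_append (k k' : List ℕ) : encode (k ++ k') = encode k ++ encode k' := by
  simp [encode]

theorem coeff_liSeries_append_zeros (w : List (Fin 2)) (c m : ℕ) :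
    coeff m (liSeries (w ++ List.replicate c 0)) * (m : ℝ) ^ c =
      if m = 0 ∧ c ≠ 0 then 0 else coeff m (liSeries w) := by
  induction c with
  | zero => simp
  | succ c ih =>
    rw [List.replicate_succ', ← List.append_assoc, liSeries_concat, coeff_letterOp_zero]
    rcases Nat.eq_zero_or_pos m with rfl | hm
    · simp
    · have : (m : ℝ) ≠ 0 := by positivity
      simp only [hm.ne', false_and, if_false] at ih ⊢
      rw [← ih, pow_succ]
      field_simp

theorem coeff_liSeries_encode_concat (k : List ℕ) {c : ℕ} (m : ℕ) (hc : 1 ≤ c) :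
    coeff m (liSeries (encode (k ++ [c]))) =
      (∑ j ∈ Finset.range m, coeff j (liSeries (encode k))) / (m : ℝ) ^ c := by
  obtain ⟨c, rfl⟩ := Nat.exists_eq_add_of_le' hc
  have h : encode (k ++ [c + 1]) = (encode k ++ [1]) ++ List.replicate c 0 := by
    simp [encode]
  rcases Nat.eq_zero_or_pos m with rfl | hm
  · rw [h, coeff_zero_liSeries (by simp)]; simp
  · have hm' : (m : ℝ) ≠ 0 := by positivity
    have h1 := coeff_liSeries_append_zeros (encode k ++ [1]) c m
    rw [if_neg (by simp [hm.ne']), liSeries_concat, coeff_letterOp_one] at h1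
    rw [h, eq_div_iff (by positivity), pow_succ, ← mul_assoc, h1]
    field_simp

/-- Truncated multiple harmonic sums are partial sums of the coefficients of `liSeries`, and the
coefficients themselves are nested sums over the tuples with a given last entry. For `m = 0` the
first claim fails if `n = 0`. -/
theorem sum_incTuplesBelow_eq {n : ℕ} (κ : Fin n → ℕ) (hκ : ∀ u, 1 ≤ κ u) {m : ℕ} (hm : 0 < m) :
    ∑ t ∈ incTuplesBelow n m, 1 / ∏ u, (t u : ℝ) ^ κ u =
      ∑ j ∈ Finset.range m, coeff j (liSeries (encode (List.ofFn κ))) ∧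
    ∀ (c : ℕ) (j : ℕ), 1 ≤ c → coeff j (liSeries (encode (List.ofFn κ ++ [c]))) =
      ∑ t ∈ incInits n j, 1 / ((∏ u, (t u : ℝ) ^ κ u) * (j : ℝ) ^ c) := by
  have second : ∀ (n : ℕ) (κ : Fin n → ℕ), (∀ m, 0 < m →
      ∑ t ∈ incTuplesBelow n m, 1 / ∏ u, (t u : ℝ) ^ κ u =
        ∑ j ∈ Finset.range m, coeff j (liSeries (encode (List.ofFn κ)))) →
      ∀ (c : ℕ) (j : ℕ), 1 ≤ c → coeff j (liSeries (encode (List.ofFn κ ++ [c]))) =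
      ∑ t ∈ incInits n j, 1 / ((∏ u, (t u : ℝ) ^ κ u) * (j : ℝ) ^ c) := by
    intro n κ h c j hc
    rw [coeff_liSeries_encode_concat _ _ hc]
    rcases Nat.eq_zero_or_pos j with rfl | hj
    · simp [incInits]
    · rw [← h j hj, incInits, if_pos hj, Finset.sum_div]
      simp only [div_div]
  have first : ∀ m, 0 < m → ∑ t ∈ incTuplesBelow n m, 1 / ∏ u, (t u : ℝ) ^ κ u =
        ∑ j ∈ Finset.range m, coeff j (liSeries (encode (List.ofFn κ))) := by
    clear hm m
    induction n with
    | zero =>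
      intro m hm
      obtain ⟨m, rfl⟩ := Nat.exists_eq_add_of_le' hm
      have : incTuplesBelow 0 (m + 1) = {Fin.elim0} := by
        ext t
        simp [mem_incTuplesBelow, Subsingleton.elim t Fin.elim0, Subsingleton.strictMono]
      rw [this, Finset.sum_singleton]
      simp [encode, liSeries_nil, coeff_one]
    | succ n ih =>
      intro m hm
      rw [sum_incTuplesBelow_succ]
      refine Finset.sum_congr rfl fun j _ => ?_
      have h := second n (fun u => κ u.castSucc) (ih _ fun u => hκ _) (κ (Fin.last n)) j (hκ _)
      rw [List.ofFn_succ', List.concat_eq_append, h]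
      refine Finset.sum_congr rfl fun t _ => ?_
      rw [Fin.prod_univ_castSucc]
      simp
  exact ⟨first m hm, second n κ first⟩

/-- The coefficient of `z ^ m_n` in `Li_k(z)`, as a sum over the tuples with last entry `m_n`; hence
the series over tuples is the evaluation of a power series. -/
theorem tsum_incTuple_eq {n : ℕ} (κ : Fin (n + 1) → ℕ) (hκ : ∀ u, 1 ≤ κ u) (z : ℂ)
    (hs : Summable fun m => ‖((coeff m (liSeries (encode (List.ofFn κ))) : ℝ) : ℂ) * z ^ m‖) :
    ∑' m : IncTuple (n + 1), z ^ m.1 (Fin.last n) / ∏ u, (m.1 u : ℂ) ^ κ u =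
      ∑' m : ℕ, ((coeff m (liSeries (encode (List.ofFn κ))) : ℝ) : ℂ) * z ^ m := by
  let E : IncTuple (n + 1) ≃ Σ j : ℕ, {t : Fin n → ℕ // t ∈ incInits n j} :=
    { toFun := fun m => ⟨m.1 (Fin.last n), Fin.init m.1, mem_incInits.2 (snoc_inc_iff.1 (by
        rw [Fin.snoc_init_self]; exact m.2))⟩
      invFun := fun x => ⟨Fin.snoc (α := fun _ => ℕ) x.2.1 x.1, snoc_inc_iff.2 (mem_incInits.1 x.2.2)⟩
      left_inv := fun m => Subtype.ext (Fin.snoc_init_self m.1)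
      right_inv := by
        rintro ⟨j, t, ht⟩
        have key : ∀ j' t' h', j' = j → t' = t →
            (⟨j', ⟨t', h'⟩⟩ : Σ j : ℕ, {t : Fin n → ℕ // t ∈ incInits n j}) = ⟨j, ⟨t, ht⟩⟩ := by
          rintro _ _ _ rfl rfl; rfl
        exact key _ _ _ (Fin.snoc_last (α := fun _ => ℕ) j t)
          (Fin.init_snoc (α := fun _ => ℕ) j t) }
  have hcoeff : ∀ j, coeff j (liSeries (encode (List.ofFn κ))) =
      ∑ t : {t : Fin n → ℕ // t ∈ incInits n j},
        1 / ((∏ u, (t.1 u : ℝ) ^ κ u.castSucc) * (j : ℝ) ^ κ (Fin.last n)) := by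
    intro j
    rw [List.ofFn_succ', List.concat_eq_append,
      (sum_incTuplesBelow_eq (fun u => κ u.castSucc) (fun u => hκ _) one_pos).2 _ j (hκ _)]
    exact (Finset.sum_coe_sort (incInits n j) fun t =>
      1 / ((∏ u, (t u : ℝ) ^ κ u.castSucc) * (j : ℝ) ^ κ (Fin.last n))).symm
  let g : (Σ j : ℕ, {t : Fin n → ℕ // t ∈ incInits n j}) → ℂ := fun x =>
    ((1 / ((∏ u, (x.2.1 u : ℝ) ^ κ u.castSucc) * (x.1 : ℝ) ^ κ (Fin.last n)) : ℝ) : ℂ) * z ^ x.1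
  have hfib : ∀ j, ∑' t, g ⟨j, t⟩ = ((coeff j (liSeries (encode (List.ofFn κ))) : ℝ) : ℂ) * z ^ j := by
    intro j
    rw [tsum_fintype, hcoeff, Complex.ofReal_sum, Finset.sum_mul]
  have hg : Summable g := by
    refine Summable.of_norm ((summable_sigma_of_nonneg fun _ => norm_nonneg _).2
      ⟨fun j => (hasSum_fintype _).summable, hs.congr fun j => ?_⟩)
    rw [tsum_fintype, hcoeff, norm_mul, Complex.norm_real, Real.norm_of_nonneg
      (Finset.sum_nonneg fun _ _ => by positivity), Finset.sum_mul]
    refine Finset.sum_congr rfl fun t _ => ?_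
    rw [norm_mul, Complex.norm_real, Real.norm_of_nonneg (by positivity)]
  rw [← tsum_congr hfib, ← hg.tsum_sigma' fun j => (hasSum_fintype _).summable, ← E.tsum_eq]
  refine tsum_congr fun m => ?_
  simp only [g, E, Equiv.coe_fn_mk, Fin.prod_univ_castSucc, Fin.init]
  push_cast
  rw [div_eq_mul_one_div, mul_comm]

/-! ### Words and indices -/

theorem encode_decode (w : List (Fin 2)) :
    List.replicate (decode w).1 0 ++ encode (decode w).2 = w := by
  induction w with
  | nil => rfl
  | cons a w ih =>
    fin_cases a
    · conv_rhs => rw [← ih]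
      simp [decode, List.replicate_succ]
    · conv_rhs => rw [← ih]
      simp [decode, encode]

theorem one_le_of_mem_decode (w : List (Fin 2)) : ∀ a ∈ (decode w).2, 1 ≤ a := by
  induction w with
  | nil => simp [decode]
  | cons a w ih =>
    fin_cases a
    · simpa [decode] using ih
    · simpa [decode] using ih

theorem decode_fst_of_proper {w : List (Fin 2)} (h : Proper w) : (decode w).1 = 0 := by
  cases w with
  | nil => rfl
  | cons a w =>
    obtain rfl : a = 1 := h a (by simp)
    simp [decode]

/-- The words of admissible indices: the empty word, and the words `e₁ ⋯ e₀`. -/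
def AdmWord (w : List (Fin 2)) : Prop := Proper w ∧ (w = [] ∨ ∃ u, w = u ++ [0])

theorem AdmWord.admissible_decode {w : List (Fin 2)} (h : AdmWord w) :
    Admissible (decode w).2 := by
  refine ⟨one_le_of_mem_decode w, fun hne => ?_⟩
  have hpos := one_le_of_mem_decode w
  have hw := encode_decode w
  rw [decode_fst_of_proper h.1, List.replicate_zero, List.nil_append] at hw
  obtain ⟨k, c, hk⟩ : ∃ k c, (decode w).2 = k ++ [c] :=
    ⟨_, _, (List.dropLast_append_getLast hne).symm⟩
  simp only [hk, List.getLast_append_singleton] at hpos hw ⊢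
  by_contra hc
  obtain rfl : c = 1 := by have := hpos c (by simp); omega
  rcases h.2 with rfl | ⟨u, rfl⟩
  · simp [encode] at hw
  · rw [encode_append] at hw
    have := congrArg List.getLast? hw
    simp [encode] at this

theorem L_word_of_proper (z : ℂ) {w : List (Fin 2)} (h : Proper w) :
    L z (word w) = multiLi (decode w).2 z := by
  conv_lhs => rw [← encode_decode w]
  rw [decode_fst_of_proper h, List.replicate_zero, List.nil_append,
    L_word_encode z _ (one_le_of_mem_decode w)]

theorem multiLi_one (k : List ℕ) : multiLi k 1 = mzv k := by
  cases k with
  | nil =>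
    have : Unique (IncTuple 0) :=
      { default := ⟨Fin.elim0, Subsingleton.strictMono _, fun u => u.elim0⟩
        uniq := fun a => Subtype.ext (Subsingleton.elim _ _) }
    simp [multiLi, mzv]
  | cons a t =>
    rw [multiLi, mzv, Complex.ofReal_tsum]
    refine tsum_congr fun m => ?_
    push_cast
    rw [one_pow]
    rfl

/-! ### Evaluation of the generating series -/

/-- The linear map that sends a word to its polylogarithm series. Unlike `L` it is the sum of the
power series also for the words that end in `e₁`, and it vanishes on those that begin with `e₀`. -/
def polylog (z : ℂ) : H →ₗ[ℚ] ℂ :=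
  wordBasis.constr ℚ fun w => ∑' m : ℕ, ((coeff m (liSeries w.toList) : ℝ) : ℂ) * z ^ m

theorem polylog_word (z : ℂ) (w : List (Fin 2)) :
    polylog z (word w) = ∑' m : ℕ, ((coeff m (liSeries w) : ℝ) : ℂ) * z ^ m := by
  rw [polylog, ← wordBasis_apply, Module.Basis.constr_basis]
  rfl

theorem coeff_rat_smul (c : ℚ) (m : ℕ) (s : PowerSeries ℝ) : coeff m (c • s) = (c : ℝ) * coeff m s := by
  rw [← Rat.cast_smul_eq_qsmul ℝ c s, map_smul, smul_eq_mul]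

theorem summable_polylog {z : ℂ} (hz : ‖z‖ < 1) (x : H) :
    Summable fun m => ‖((coeff m (liLin x) : ℝ) : ℂ) * z ^ m‖ := by
  induction x using word_induction with
  | hw w =>
    refine Summable.of_nonneg_of_le (fun _ => norm_nonneg _) (fun m => ?_)
      (summable_geometric_of_lt_one (norm_nonneg z) hz)
    rw [liLin_word, norm_mul, norm_pow, Complex.norm_real,
      Real.norm_of_nonneg (coeff_liSeries_nonneg w m)]
    exact mul_le_of_le_one_left (by positivity) (coeff_liSeries_le_one w m)
  | h0 => simp
  | hadd x y hx hy =>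
    refine Summable.of_nonneg_of_le (fun _ => norm_nonneg _) (fun m => ?_) (hx.add hy)
    rw [map_add, map_add, Complex.ofReal_add, add_mul]
    exact norm_add_le _ _
  | hsmul c x hx =>
    refine (hx.mul_left ‖(c : ℂ)‖).congr fun m => ?_
    rw [map_smul, coeff_rat_smul, ← norm_mul]
    push_cast
    rw [mul_assoc]

theorem polylog_eq_tsum {z : ℂ} (hz : ‖z‖ < 1) (x : H) :
    polylog z x = ∑' m : ℕ, ((coeff m (liLin x) : ℝ) : ℂ) * z ^ m := by
  induction x using word_induction with
  | hw w => rw [polylog_word, liLin_word]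
  | h0 => simp
  | hadd x y hx hy =>
    rw [map_add, hx, hy, ← (summable_polylog hz x).of_norm.tsum_add (summable_polylog hz y).of_norm]
    simp [add_mul]
  | hsmul c x hx =>
    rw [map_smul, hx, ← Rat.cast_smul_eq_qsmul ℂ c, smul_eq_mul, ← tsum_mul_left]
    refine tsum_congr fun m => ?_
    rw [map_smul, coeff_rat_smul]
    push_cast
    rw [mul_assoc]

theorem polylog_shuffle {z : ℂ} (hz : ‖z‖ < 1) {x y : H} (hx : x ∈ properSpan)
    (hy : y ∈ properSpan) : polylog z (shuffle x y) = polylog z x * polylog z y := by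
  rw [polylog_eq_tsum hz, polylog_eq_tsum hz, polylog_eq_tsum hz, liLin_shuffle hx hy,
    tsum_mul_tsum_eq_tsum_sum_antidiagonal_of_summable_norm (summable_polylog hz x)
      (summable_polylog hz y)]
  refine tsum_congr fun m => ?_
  rw [coeff_mul, Complex.ofReal_sum, Finset.sum_mul]
  refine Finset.sum_congr rfl fun p hp => ?_
  rw [← Finset.HasAntidiagonal.mem_antidiagonal.1 hp]
  push_cast
  ring

theorem polylog_one (z : ℂ) : polylog z 1 = 1 := by
  rw [← word_nil, polylog_word, liSeries_nil, tsum_eq_single 0]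
  · simp
  · intro m hm; simp [coeff_one, hm]

theorem L_one (z : ℂ) : L z 1 = 1 := by
  rw [← word_nil, L_word_of_proper z (by simp [Proper])]
  simp [decode, multiLi]

theorem polylog_e_one {z : ℂ} (hz : ‖z‖ < 1) : polylog z (e 1) = -Complex.log (1 - z) := by
  rw [← (Complex.hasSum_taylorSeries_neg_log hz).tsum_eq, ← word_singleton, polylog_word]
  refine tsum_congr fun m => ?_
  rw [← List.nil_append [(1 : Fin 2)], liSeries_concat, coeff_letterOp_one, liSeries_nil]
  rcases Nat.eq_zero_or_pos m with rfl | hm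
  · simp
  · have : ∑ j ∈ Finset.range m, (coeff j (1 : PowerSeries ℝ)) = 1 := by
      simp [coeff_one, hm.ne']
    rw [this]
    push_cast
    ring

/-- Along circles of radius `ρ < 1`, appending `e₀` to a word is integration. -/
theorem hasDerivAt_polylog {ρ : ℝ} (h0 : 0 ≤ ρ) (h1 : ρ < 1) {x : H} (hx : coeff 0 (liLin x) = 0)
    (θ : ℝ) :
    HasDerivAt (fun θ : ℝ => polylog (ρ * Complex.exp (Complex.I * θ)) (x * e 0))
      (Complex.I * polylog (ρ * Complex.exp (Complex.I * θ)) x) θ := by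
  have hnorm : ∀ θ : ℝ, ‖(ρ * Complex.exp (Complex.I * θ) : ℂ)‖ = ρ := fun θ => by
    rw [norm_mul, mul_comm Complex.I, Complex.norm_exp_ofReal_mul_I, mul_one, Complex.norm_real,
      Real.norm_of_nonneg h0]
  have hlt : ∀ θ : ℝ, ‖(ρ * Complex.exp (Complex.I * θ) : ℂ)‖ < 1 := fun θ => (hnorm θ).trans_lt h1
  simp only [polylog_eq_tsum (hlt _), liLin_mul_e, coeff_letterOp_zero]
  rw [← tsum_mul_left]
  have hρ : ‖(ρ : ℂ)‖ < 1 := by rwa [Complex.norm_real, Real.norm_of_nonneg h0]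
  refine hasDerivAt_tsum (𝕜 := ℝ) (u := fun m => ‖((coeff m (liLin x) : ℝ) : ℂ) * (ρ : ℂ) ^ m‖)
    (g := fun (m : ℕ) (θ : ℝ) =>
      ((coeff m (liLin x) / m : ℝ) : ℂ) * (ρ * Complex.exp (Complex.I * θ)) ^ m)
    (g' := fun (m : ℕ) (θ : ℝ) => Complex.I *
      (((coeff m (liLin x) : ℝ) : ℂ) * (ρ * Complex.exp (Complex.I * θ)) ^ m))
    (y₀ := 0) (summable_polylog hρ x) (fun m θ => ?_) (fun m θ => ?_) ?_ θ
  · have h2 : HasDerivAt (fun θ : ℝ => Complex.exp (Complex.I * θ))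
        (Complex.exp (Complex.I * θ) * (Complex.I * 1)) θ :=
      ((Complex.ofRealCLM.hasDerivAt (x := θ)).const_mul Complex.I).cexp
    have h3 := ((h2.const_mul (ρ : ℂ)).pow m).const_mul ((coeff m (liLin x) / m : ℝ) : ℂ)
    refine h3.congr_deriv ?_
    rcases m with _ | m
    · simp [hx]
    · have : ((m + 1 : ℕ) : ℂ) ≠ 0 := by exact_mod_cast m.succ_ne_zero
      push_cast at this ⊢
      field_simp
      ring
  · simp only [norm_mul, norm_pow, Complex.norm_I, one_mul]
    rw [mul_comm Complex.I, Complex.norm_exp_ofReal_mul_I, mul_one]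
  · have := summable_polylog (hlt 0) (x * e 0)
    simp only [liLin_mul_e, coeff_letterOp_zero] at this
    exact this.of_norm

/-! ### Admissible elements -/

theorem AdmWord.summable {w : List (Fin 2)} (h : AdmWord w) :
    Summable fun m => coeff m (liSeries w) := by
  rcases h.2 with rfl | ⟨u, rfl⟩
  · exact summable_of_ne_finset_zero (s := {0}) fun m hm => by
      simp_all [liSeries_nil, coeff_one]
  · exact summable_coeff_liSeries_concat_zero u

/-- The span of the words of admissible indices. -/
def admSpan : Submodule ℚ H := Submodule.span ℚ (word '' {w | AdmWord w})

theorem norm_coeff_mul_pow_le {z : ℂ} (hz : ‖z‖ ≤ 1) (w : List (Fin 2)) (m : ℕ) :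
    ‖((coeff m (liSeries w) : ℝ) : ℂ) * z ^ m‖ ≤ coeff m (liSeries w) := by
  rw [norm_mul, norm_pow, Complex.norm_real, Real.norm_of_nonneg (coeff_liSeries_nonneg w m)]
  exact mul_le_of_le_one_right (coeff_liSeries_nonneg w m) (pow_le_one₀ (norm_nonneg _) hz)

/-- The series of an admissible word is dominated on the closed disc by its value at `1`. -/
theorem continuousOn_polylog {x : H} (hx : x ∈ admSpan) :
    ContinuousOn (fun z => polylog z x) (Metric.closedBall 0 1) := by
  induction hx using Submodule.span_induction with
  | mem x hx =>
    obtain ⟨w, hw, rfl⟩ := hx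
    simp only [polylog_word]
    refine continuousOn_tsum (fun m => by fun_prop) hw.summable fun m z hz => ?_
    exact norm_coeff_mul_pow_le (mem_closedBall_zero_iff.1 hz) w m
  | zero => simpa using continuousOn_const
  | add x y _ _ hx hy => simp only [map_add]; exact hx.add hy
  | smul c x _ hx =>
    simp only [map_smul]
    exact hx.const_smul c

theorem L_eq_polylog {x : H} (hx : x ∈ admSpan) {z : ℂ} (hz : ‖z‖ ≤ 1) :
    L z x = polylog z x := by
  induction hx using Submodule.span_induction with
  | mem x hx =>
    obtain ⟨w, hw, rfl⟩ := hx
    rw [L_word_of_proper z hw.1, polylog_word]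
    have h1 := one_le_of_mem_decode w
    have h2 := encode_decode w
    rw [decode_fst_of_proper hw.1, List.replicate_zero, List.nil_append] at h2
    rcases h : (decode w).2 with _ | ⟨a, t⟩
    · rw [h] at h2
      rw [← h2, multiLi, ← polylog_word]
      exact (polylog_one z).symm
    · rw [h] at h1 h2
      have h3 := tsum_incTuple_eq (a :: t).get (fun u => h1 _ (List.get_mem _ _)) z
      rw [List.ofFn_get, h2] at h3
      exact h3 (Summable.of_nonneg_of_le (fun _ => norm_nonneg _)
        (norm_coeff_mul_pow_le hz w) hw.summable)
  | zero => simp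
  | add x y _ _ hx hy => simp [hx, hy]
  | smul c x _ hx => simp [hx]

theorem e_one_mul_mem_properSpan (x : H) : e 1 * x ∈ properSpan := by
  induction x using word_induction with
  | hw w => exact Submodule.subset_span ⟨1 :: w, by simp [Proper], word_cons 1 w⟩
  | h0 => simp
  | hadd x y hx hy => rw [mul_add]; exact add_mem hx hy
  | hsmul c x hx => rw [mul_smul_comm]; exact Submodule.smul_mem _ _ hx

theorem e_one_mul_e_zero_mem_admSpan (x : H) : e 1 * x * e 0 ∈ admSpan := by
  induction x using word_induction with
  | hw w =>
    refine Submodule.subset_span ⟨1 :: w ++ [0], ⟨by simp [Proper], Or.inr ⟨1 :: w, rfl⟩⟩, ?_⟩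
    rw [word_append, word_cons, word_singleton]
  | h0 => simp
  | hadd x y hx hy => rw [mul_add, add_mul]; exact add_mem hx hy
  | hsmul c x hx => rw [mul_smul_comm, smul_mul_assoc]; exact Submodule.smul_mem _ _ hx

theorem one_mem_properSpan : (1 : H) ∈ properSpan :=
  Submodule.subset_span ⟨[], by simp [Proper], word_nil⟩

theorem one_mem_admSpan : (1 : H) ∈ admSpan :=
  Submodule.subset_span ⟨[], ⟨by simp [Proper], Or.inl rfl⟩, word_nil⟩

/-- The linear combinations of words that begin with `e₁`. -/
def oneSpan : Submodule ℚ H := LinearMap.range (LinearMap.mulLeft ℚ (e 1))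

theorem oneSpan_le_properSpan : oneSpan ≤ properSpan := by
  rintro _ ⟨x, rfl⟩
  exact e_one_mul_mem_properSpan x

theorem shuffleWord_mem_oneSpan {u v : List (Fin 2)} (hu : Proper u) (hv : Proper v)
    (h : u ≠ [] ∨ v ≠ []) : shuffleWord u v ∈ oneSpan := by
  have key : ∀ v : List (Fin 2), Proper v → v ≠ [] → word v ∈ oneSpan := by
    rintro (_ | ⟨a, v⟩) hv hne
    · exact absurd rfl hne
    · obtain rfl : a = 1 := hv a (by simp)
      exact ⟨word v, (word_cons 1 v).symm⟩
  rcases u with _ | ⟨a, u⟩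
  · rw [shuffleWord_nil_left]; exact key v hv (by simpa using h)
  rcases v with _ | ⟨b, v⟩
  · rw [shuffleWord_nil_right]; exact key _ hu (by simp)
  obtain rfl : a = 1 := hu a (by simp)
  obtain rfl : b = 1 := hv b (by simp)
  rw [shuffleWord_cons_cons]
  exact add_mem ⟨_, rfl⟩ ⟨_, rfl⟩

theorem oneSpan_eq_span : oneSpan = Submodule.span ℚ (word '' {w | Proper w ∧ w ≠ []}) := by
  refine le_antisymm ?_ (Submodule.span_le.2 ?_)
  · rintro _ ⟨x, rfl⟩
    rw [LinearMap.mulLeft_apply]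
    induction x using word_induction with
    | hw w =>
      exact Submodule.subset_span ⟨1 :: w, ⟨by simp [Proper], by simp⟩, word_cons 1 w⟩
    | h0 => simp
    | hadd x y hx hy => rw [mul_add]; exact add_mem hx hy
    | hsmul c x hx => rw [mul_smul_comm]; exact Submodule.smul_mem _ _ hx
  · rintro _ ⟨w, ⟨hw, hne⟩, rfl⟩
    have := shuffleWord_mem_oneSpan hw (v := []) (by simp [Proper]) (Or.inl hne)
    rwa [shuffleWord_nil_right] at this

theorem shuffle_mem_oneSpan_left {x y : H} (hx : x ∈ oneSpan) (hy : y ∈ properSpan) :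
    shuffle x y ∈ oneSpan := by
  rw [oneSpan_eq_span] at hx
  induction hx, hy using Submodule.span_induction₂ with
  | mem_mem x y hx hy =>
    obtain ⟨u, hu, rfl⟩ := hx
    obtain ⟨v, hv, rfl⟩ := hy
    rw [shuffle_word]
    exact shuffleWord_mem_oneSpan hu.1 hv (Or.inl hu.2)
  | zero_left y hy => simp
  | zero_right x hx => simp
  | add_left x y z _ _ _ h1 h2 => simpa using add_mem h1 h2
  | add_right x y z _ _ _ h1 h2 => simpa using add_mem h1 h2
  | smul_left r x y _ _ h => simpa using Submodule.smul_mem _ r h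
  | smul_right r x y _ _ h => simpa using Submodule.smul_mem _ r h

theorem shuffle_mem_oneSpan_right {x y : H} (hx : x ∈ properSpan) (hy : y ∈ oneSpan) :
    shuffle x y ∈ oneSpan := by
  rw [oneSpan_eq_span] at hy
  induction hx, hy using Submodule.span_induction₂ with
  | mem_mem x y hx hy =>
    obtain ⟨u, hu, rfl⟩ := hx
    obtain ⟨v, hv, rfl⟩ := hy
    rw [shuffle_word]
    exact shuffleWord_mem_oneSpan hu hv.1 (Or.inr hv.2)
  | zero_left y hy => simp
  | zero_right x hx => simp
  | add_left x y z _ _ _ h1 h2 => simpa using add_mem h1 h2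
  | add_right x y z _ _ _ h1 h2 => simpa using add_mem h1 h2
  | smul_left r x y _ _ h => simpa using Submodule.smul_mem _ r h
  | smul_right r x y _ _ h => simpa using Submodule.smul_mem _ r h

theorem e_one_mem_oneSpan : e 1 ∈ oneSpan := ⟨1, mul_one _⟩

theorem shufflePow_mem_oneSpan {r : ℕ} (hr : r ≠ 0) : shufflePow (e 1) r ∈ oneSpan := by
  induction r with
  | zero => exact absurd rfl hr
  | succ r ih =>
    refine shuffle_mem_oneSpan_right ?_ e_one_mem_oneSpan
    rcases eq_or_ne r 0 with rfl | h
    · exact one_mem_properSpan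
    · exact oneSpan_le_properSpan (ih h)

theorem shufflePow_mem_properSpan (r : ℕ) : shufflePow (e 1) r ∈ properSpan := by
  rcases eq_or_ne r 0 with rfl | h
  · exact one_mem_properSpan
  · exact oneSpan_le_properSpan (shufflePow_mem_oneSpan h)

theorem polylog_shufflePow {z : ℂ} (hz : ‖z‖ < 1) (r : ℕ) :
    polylog z (shufflePow (e 1) r) = polylog z (e 1) ^ r := by
  induction r with
  | zero => exact polylog_one z
  | succ r ih =>
    rw [shufflePow, polylog_shuffle hz (shufflePow_mem_properSpan r)
      (oneSpan_le_properSpan e_one_mem_oneSpan), ih, pow_succ]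

theorem coeff_zero_liLin_of_mem_oneSpan {x : H} (hx : x ∈ oneSpan) : coeff 0 (liLin x) = 0 := by
  rw [oneSpan_eq_span] at hx
  induction hx using Submodule.span_induction with
  | mem x hx =>
    obtain ⟨w, hw, rfl⟩ := hx
    rw [liLin_word, coeff_zero_liSeries hw.2]
  | zero => simp
  | add x y _ _ hx hy => rw [map_add, map_add, hx, hy, add_zero]
  | smul c x _ hx => rw [map_smul, coeff_rat_smul, hx, mul_zero]

theorem w_nil : w [] [] = 1 := by rw [w]; simp

theorem w_concat (j r : List ℕ) (i b : ℕ) :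
    w (j ++ [i]) (r ++ [b]) = shuffle (w j r) (shufflePow (e 1) b) * e 0 ^ (1 + i) := by
  rw [w]; simp

theorem mul_e_pow_mem_oneSpan {x : H} (hx : x ∈ oneSpan) (i : ℕ) : x * e 0 ^ i ∈ oneSpan := by
  obtain ⟨y, rfl⟩ := hx
  exact ⟨y * e 0 ^ i, (mul_assoc _ _ _).symm⟩

theorem w_mem_oneSpan {j r : List ℕ} (h : j.length = r.length) (hne : r ≠ [])
    (hr : r.head? ≠ some 0) : w j r ∈ oneSpan := by
  induction r using List.reverseRecOn generalizing j with
  | nil => exact absurd rfl hne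
  | append_singleton r b ih =>
    rcases List.eq_nil_or_concat' j with rfl | ⟨j, i, rfl⟩
    · simp at h
    rw [w_concat]
    refine mul_e_pow_mem_oneSpan ?_ _
    rcases eq_or_ne r [] with rfl | hr'
    · obtain rfl : j = [] := by simpa using h
      refine shuffle_mem_oneSpan_right ?_ (shufflePow_mem_oneSpan ?_)
      · rw [w_nil]; exact one_mem_properSpan
      · simpa using hr
    · refine shuffle_mem_oneSpan_left (ih (by simpa using h) hr' ?_) (shufflePow_mem_properSpan b)
      rwa [List.head?_append_of_ne_nil _ hr'] at hr

theorem w_mem_properSpan {j r : List ℕ} (h : j.length = r.length) (hr : r.head? ≠ some 0) :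
    w j r ∈ properSpan := by
  rcases eq_or_ne r [] with rfl | hne
  · obtain rfl : j = [] := by simpa using h
    rw [w_nil]; exact one_mem_properSpan
  · exact oneSpan_le_properSpan (w_mem_oneSpan h hne hr)

theorem shuffle_w_mem_oneSpan {j r : List ℕ} {b : ℕ} (h : j.length = r.length)
    (hr : (r ++ [b]).head? ≠ some 0) : shuffle (w j r) (shufflePow (e 1) b) ∈ oneSpan := by
  rcases eq_or_ne r [] with rfl | hr'
  · refine shuffle_mem_oneSpan_right (w_mem_properSpan h (by simp)) (shufflePow_mem_oneSpan ?_)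
    simpa using hr
  · rw [List.head?_append_of_ne_nil _ hr'] at hr
    exact shuffle_mem_oneSpan_left (w_mem_oneSpan h hr' hr) (shufflePow_mem_properSpan b)

/-- If `r` does not begin with `0`, then `w_j^r` is a combination of words of admissible indices; in
particular its series converges absolutely on the closed unit disc. -/
theorem w_mem_admSpan {j r : List ℕ} (h : j.length = r.length) (hr : r.head? ≠ some 0) :
    w j r ∈ admSpan := by
  rcases List.eq_nil_or_concat' r with rfl | ⟨r, b, rfl⟩
  · obtain rfl : j = [] := by simpa using h
    rw [w_nil]; exact one_mem_admSpan
  rcases List.eq_nil_or_concat' j with rfl | ⟨j, i, rfl⟩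
  · simp at h
  rw [w_concat, add_comm, pow_succ, ← mul_assoc]
  obtain ⟨y, hy⟩ := mul_e_pow_mem_oneSpan (shuffle_w_mem_oneSpan (b := b) (by simpa using h) hr) i
  rw [← hy]
  exact e_one_mul_e_zero_mem_admSpan y

end

/-! ### The functions `f` on circles of radius `ρ` -/

/-- The sum that defines `f`, with the polylogarithms evaluated on the circle of radius `ρ`. -/
def fReg (q r : List ℕ) (ρ σ : ℝ) : ℂ :=
  let n' := leadingZeros r
  (B (q.take n') : ℂ) * ∑ j ∈ precFinset (bar n' q),
    (C (bar n' q) j : ℂ) * (Complex.I * σ) ^ (q.sum + n' - j.sum)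
      * polylog (ρ * Complex.exp (Complex.I * σ)) (w j (r.drop n'))

theorem head?_drop_leadingZeros (r : List ℕ) : (r.drop (leadingZeros r)).head? ≠ some 0 := by
  induction r with
  | nil => simp [leadingZeros]
  | cons a r ih =>
    rcases eq_or_ne a 0 with rfl | h
    · simpa [leadingZeros] using ih
    · simp [leadingZeros, h]

theorem eq_replicate_append (r : List ℕ) :
    r = List.replicate (leadingZeros r) 0 ++ r.drop (leadingZeros r) := by
  induction r with
  | nil => simp [leadingZeros]
  | cons a r ih =>
    rcases eq_or_ne a 0 with rfl | h
    · simpa [leadingZeros, List.replicate_succ] using ih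
    · simp [leadingZeros, h]

theorem leadingZeros_replicate_append (n : ℕ) {r : List ℕ} (hr : r.head? ≠ some 0) :
    leadingZeros (List.replicate n 0 ++ r) = n := by
  induction n with
  | zero => cases r <;> simp_all [leadingZeros]
  | succ n ih => simpa [List.replicate_succ, leadingZeros] using ih

theorem bar_length {q : List ℕ} {n' : ℕ} : (bar n' q).length = (q.drop n').length := by
  unfold bar
  rcases q.drop n' with _ | ⟨a, t⟩ <;> simp

theorem w_bar_mem_admSpan {q r j : List ℕ} (h : q.length = r.length)
    (hj : j ∈ precFinset (bar (leadingZeros r) q)) : w j (r.drop (leadingZeros r)) ∈ admSpan := by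
  refine w_mem_admSpan ?_ (head?_drop_leadingZeros r)
  rw [(mem_precFinset.1 hj).1, bar_length, List.length_drop, List.length_drop, h]

theorem norm_exp_I_mul (σ : ℝ) : ‖Complex.exp (Complex.I * σ)‖ = 1 := by
  rw [mul_comm, Complex.norm_exp_ofReal_mul_I]

theorem f_eq_fReg {q r : List ℕ} (h : q.length = r.length) (σ : ℝ) : f q r σ = fReg q r 1 σ := by
  simp only [f, fReg]
  congr 1
  refine Finset.sum_congr rfl fun j hj => ?_
  rw [L_eq_polylog (w_bar_mem_admSpan h hj) (norm_exp_I_mul σ).le, Complex.ofReal_one, one_mul]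

theorem continuousOn_fReg {q r : List ℕ} (h : q.length = r.length) :
    ContinuousOn (fun p : ℝ × ℝ => fReg q r p.1 p.2) (Set.Icc 0 1 ×ˢ Set.univ) := by
  simp only [fReg]
  refine continuousOn_const.mul (continuousOn_finsetSum _ fun j hj => ?_)
  refine ContinuousOn.mul (by fun_prop) ?_
  refine (continuousOn_polylog (w_bar_mem_admSpan h hj)).comp (t := Metric.closedBall 0 1)
    (f := fun p : ℝ × ℝ => (p.1 : ℂ) * Complex.exp (Complex.I * p.2)) (by fun_prop) ?_
  rintro ⟨ρ, θ⟩ ⟨⟨h0, h1⟩, -⟩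
  rw [mem_closedBall_zero_iff, norm_mul, norm_exp_I_mul, mul_one, Complex.norm_real,
    Real.norm_of_nonneg h0]
  exact h1

theorem continuous_f {q r : List ℕ} (h : q.length = r.length) : Continuous (f q r) := by
  have : f q r = (fun p : ℝ × ℝ => fReg q r p.1 p.2) ∘ fun σ => (1, σ) := by
    ext σ; exact f_eq_fReg h σ
  rw [this]
  exact (continuousOn_fReg h).comp_continuous (by fun_prop) fun σ => by simp

/-! ### Splitting off the last entry of an index -/

theorem prec_concat {j Q : List ℕ} (h : j.length = Q.length) (i a : ℕ) :
    Prec (j ++ [i]) (Q ++ [a]) ↔ Prec j Q ∧ j.sum + i ≤ Q.sum + a := by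
  constructor
  · intro hp
    refine ⟨fun m hm => ?_, ?_⟩
    · have := hp m (by simp; omega)
      rwa [List.take_append_of_le_length (by omega), List.take_append_of_le_length hm] at this
    · have := hp (Q ++ [a]).length le_rfl
      rw [List.take_length, List.take_of_length_le (by simp [h])] at this
      simpa using this
  · rintro ⟨h1, h2⟩ m hm
    rcases Nat.lt_or_ge Q.length m with hlt | hle
    · rw [List.take_of_length_le (by simp; omega), List.take_of_length_le (by simp; omega)]
      simpa using h2
    · rw [List.take_append_of_le_length (by omega), List.take_append_of_le_length hle]
      exact h1 m hle

theorem sum_le_of_mem_precFinset {j Q : List ℕ} (h : j ∈ precFinset Q) : j.sum ≤ Q.sum := by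
  obtain ⟨h1, h2⟩ := mem_precFinset.1 h
  have := h2 Q.length le_rfl
  rwa [List.take_length, ← h1, List.take_length] at this

theorem sum_precFinset_concat {M : Type*} [AddCommMonoid M] (Q : List ℕ) (a : ℕ) (φ : List ℕ → M) :
    ∑ j ∈ precFinset (Q ++ [a]), φ j =
      ∑ j ∈ precFinset Q, ∑ i ∈ Finset.range (Q.sum + a - j.sum + 1), φ (j ++ [i]) := by
  rw [Finset.sum_sigma']
  symm
  refine Finset.sum_bij (fun x _ => x.1 ++ [x.2]) ?_ ?_ ?_ ?_
  · rintro ⟨j, i⟩ hx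
    obtain ⟨hj, hi⟩ := Finset.mem_sigma.1 hx
    have h1 := sum_le_of_mem_precFinset hj
    have hi := Finset.mem_range.1 hi
    obtain ⟨h2, h3⟩ := mem_precFinset.1 hj
    refine mem_precFinset.2 ⟨by simp [h2], (prec_concat h2 _ _).2 ⟨h3, ?_⟩⟩
    dsimp only at hi h1 ⊢
    omega
  · rintro ⟨j, i⟩ _ ⟨j', i'⟩ _ h
    obtain ⟨rfl, h'⟩ := List.append_inj' h rfl
    simp_all
  · intro x hx
    obtain ⟨h1, h2⟩ := mem_precFinset.1 hx
    rcases List.eq_nil_or_concat' x with rfl | ⟨j, i, rfl⟩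
    · simp at h1
    have h3 : j.length = Q.length := by simpa using h1
    obtain ⟨h4, h5⟩ := (prec_concat h3 _ _).1 h2
    refine ⟨⟨j, i⟩, ?_, rfl⟩
    rw [Finset.mem_sigma, Finset.mem_range]
    refine ⟨mem_precFinset.2 ⟨h3, h4⟩, ?_⟩
    dsimp only
    omega
  · intro _ _; rfl

theorem precFinset_nil : precFinset [] = {[]} := by
  ext j
  rw [mem_precFinset, Finset.mem_singleton, List.length_nil, List.length_eq_zero_iff]
  constructor
  · exact fun h => h.1
  · rintro rfl; exact ⟨rfl, fun m _ => le_rfl⟩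

theorem B_nil : B [] = 1 := by rw [B]; simp

theorem B_concat (q : List ℕ) (a : ℕ) :
    B (q ++ [a]) = 1 / ((q.sum : ℚ) + a + q.length + 1) * B q := by
  rw [B]
  simp
  left
  ring

theorem C_nil (j : List ℕ) : C [] j = 1 := by rw [C]; simp

theorem C_concat (Q j : List ℕ) (a i : ℕ) :
    C (Q ++ [a]) (j ++ [i]) = (-1) ^ i *
      (((Q.sum + a - j.sum).factorial : ℚ) / (Q.sum + a - (j.sum + i)).factorial) * C Q j := by
  rw [C]
  simp

/-! ### Differentiation -/

/-- Repeated integration by parts: if `p (i + 1)` is a primitive of `i p i`, this sum is a primitive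
of `i (iσ)^M p 0`. -/
theorem hasDerivAt_byParts (M : ℕ) (p : ℕ → ℝ → ℂ)
    (hp : ∀ i σ, HasDerivAt (p (i + 1)) (Complex.I * p i σ) σ) (σ : ℝ) :
    HasDerivAt (fun σ : ℝ => ∑ i ∈ Finset.range (M + 1),
        (-1) ^ i * ((M.factorial : ℂ) / (M - i).factorial) * (Complex.I * σ) ^ (M - i) * p (i + 1) σ)
      (Complex.I * (Complex.I * σ) ^ M * p 0 σ) σ := by
  induction M generalizing p with
  | zero => simpa using hp 0 σ
  | succ M ih =>
    have hx : HasDerivAt (fun σ : ℝ => Complex.I * (σ : ℂ)) Complex.I σ := by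
      simpa using (Complex.ofRealCLM.hasDerivAt (x := σ)).const_mul Complex.I
    have h := ((hx.pow (M + 1)).mul (hp 0 σ)).sub
      ((ih (fun i => p (i + 1)) fun i => hp (i + 1)).const_mul ((M + 1 : ℕ) : ℂ))
    refine (h.congr_deriv ?_).congr_of_eventuallyEq (Filter.Eventually.of_forall fun θ => ?_)
    · simp only [Nat.add_sub_cancel, Pi.pow_apply]
      ring
    · dsimp only
      rw [Finset.sum_range_succ']
      simp only [Pi.sub_apply, Pi.mul_apply, Pi.pow_apply, Finset.mul_sum]
      rw [add_comm, sub_eq_add_neg, ← Finset.sum_neg_distrib]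
      congr 1
      · have : ((M + 1).factorial : ℂ) ≠ 0 := by exact_mod_cast (M + 1).factorial_ne_zero
        simp [div_self this]
      · refine Finset.sum_congr rfl fun i _ => ?_
        rw [Nat.factorial_succ, Nat.add_sub_add_right]
        push_cast
        ring

/-- The inner sum of `f` for `Q = q̄` and `R = r''`, with `N` in place of `|q| + n'` in the exponent. -/
def coreSum (Q R : List ℕ) (N : ℕ) (ρ σ : ℝ) : ℂ :=
  ∑ j ∈ precFinset Q, (C Q j : ℂ) * (Complex.I * σ) ^ (N - j.sum) *
    polylog (ρ * Complex.exp (Complex.I * σ)) (w j R)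

theorem coreSum_nil (N : ℕ) (ρ σ : ℝ) : coreSum [] [] N ρ σ = (Complex.I * σ) ^ N := by
  simp [coreSum, precFinset_nil, C_nil, w_nil, polylog_one]

theorem norm_mul_exp_lt_one {ρ : ℝ} (h0 : 0 ≤ ρ) (h1 : ρ < 1) (σ : ℝ) :
    ‖(ρ * Complex.exp (Complex.I * σ) : ℂ)‖ < 1 := by
  rwa [norm_mul, norm_exp_I_mul, mul_one, Complex.norm_real, Real.norm_of_nonneg h0]

/-- Summing over the last entry of `j` first, the derivative telescopes, and the shuffle factor
`e₁^{⧢ b}` becomes the factor `Li₁^b`. -/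
theorem hasDerivAt_coreSum {ρ : ℝ} (h0 : 0 ≤ ρ) (h1 : ρ < 1) {Q R : List ℕ} (a b : ℕ)
    (h : Q.length = R.length) (hR : (R ++ [b]).head? ≠ some 0) (σ : ℝ) :
    HasDerivAt (coreSum (Q ++ [a]) (R ++ [b]) (Q.sum + a) ρ)
      (Complex.I * (Complex.I * σ) ^ a * polylog (ρ * Complex.exp (Complex.I * σ)) (e 1) ^ b *
        coreSum Q R Q.sum ρ σ) σ := by
  have hlt := norm_mul_exp_lt_one h0 h1
  have hR' : R.head? ≠ some 0 := by
    rcases eq_or_ne R [] with rfl | hne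
    · simp
    · rwa [List.head?_append_of_ne_nil _ hne] at hR
  have key : ∀ j ∈ precFinset Q, HasDerivAt (fun σ : ℝ =>
      ∑ i ∈ Finset.range (Q.sum + a - j.sum + 1), (C (Q ++ [a]) (j ++ [i]) : ℂ) *
        (Complex.I * σ) ^ (Q.sum + a - (j ++ [i]).sum) *
          polylog (ρ * Complex.exp (Complex.I * σ)) (w (j ++ [i]) (R ++ [b])))
      (C Q j * (Complex.I * (Complex.I * σ) ^ (Q.sum + a - j.sum) *
        polylog (ρ * Complex.exp (Complex.I * σ)) (shuffle (w j R) (shufflePow (e 1) b)))) σ := by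
    intro j hj
    have hu : shuffle (w j R) (shufflePow (e 1) b) ∈ oneSpan :=
      shuffle_w_mem_oneSpan ((mem_precFinset.1 hj).1.trans h) hR
    have := (hasDerivAt_byParts (Q.sum + a - j.sum) (fun i σ => polylog
      (ρ * Complex.exp (Complex.I * σ)) (shuffle (w j R) (shufflePow (e 1) b) * e 0 ^ i))
      (fun i σ => ?_) σ).const_mul (C Q j : ℂ)
    · refine (this.congr_deriv ?_).congr_of_eventuallyEq (Filter.Eventually.of_forall fun θ => ?_)
      · rw [pow_zero, mul_one]
      · simp only [Finset.mul_sum]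
        refine Finset.sum_congr rfl fun i _ => ?_
        rw [C_concat, w_concat, List.sum_append, List.sum_singleton, Nat.sub_sub, add_comm 1 i]
        push_cast
        ring
    · have := hasDerivAt_polylog h0 h1
        (coeff_zero_liLin_of_mem_oneSpan (mul_e_pow_mem_oneSpan hu i)) σ
      simpa only [pow_succ, ← mul_assoc] using this
  have hsum := HasDerivAt.fun_sum key
  refine (hsum.congr_deriv ?_).congr_of_eventuallyEq (Filter.Eventually.of_forall fun θ => ?_)
  · rw [coreSum, Finset.mul_sum]
    refine Finset.sum_congr rfl fun j hj => ?_
    rw [polylog_shuffle (hlt σ) (w_mem_properSpan ((mem_precFinset.1 hj).1.trans h) hR')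
      (shufflePow_mem_properSpan b), polylog_shufflePow (hlt σ)]
    have : Q.sum + a - j.sum = a + (Q.sum - j.sum) := by
      have := sum_le_of_mem_precFinset hj
      omega
    rw [this, pow_add]
    ring
  · rw [coreSum, sum_precFinset_concat]

/-- The index `q̄` in terms of the two parts `q₁ = q'` and `q₂ = q''` of `q`. -/
def merge (q₁ q₂ : List ℕ) : List ℕ :=
  match q₂ with
  | [] => []
  | a :: t => (q₁.sum + q₁.length + a) :: t

theorem fReg_eq_coreSum (q₁ q₂ : List ℕ) {R : List ℕ} (hR : R.head? ≠ some 0) (ρ σ : ℝ) :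
    fReg (q₁ ++ q₂) (List.replicate q₁.length 0 ++ R) ρ σ =
      B q₁ * coreSum (merge q₁ q₂) R (q₁.sum + q₂.sum + q₁.length) ρ σ := by
  have hbar : bar q₁.length (q₁ ++ q₂) = merge q₁ q₂ := by
    rw [bar, List.drop_left, List.take_left]
    cases q₂ <;> rfl
  rw [fReg, leadingZeros_replicate_append _ hR, hbar, List.take_left, List.sum_append,
    List.drop_left' (by simp)]
  rfl

/-- The differential equation for `f`, on circles of radius `ρ < 1`. -/
theorem hasDerivAt_fReg {ρ : ℝ} (h0 : 0 ≤ ρ) (h1 : ρ < 1) {q r : List ℕ} (a b : ℕ)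
    (h : q.length = r.length) (σ : ℝ) :
    HasDerivAt (fReg (q ++ [a]) (r ++ [b]) ρ)
      (Complex.I * (Complex.I * σ) ^ a * polylog (ρ * Complex.exp (Complex.I * σ)) (e 1) ^ b *
        fReg q r ρ σ) σ := by
  obtain ⟨q₁, q₂, R, rfl, rfl, h₂, hR⟩ : ∃ q₁ q₂ R : List ℕ, q = q₁ ++ q₂ ∧
      r = List.replicate q₁.length 0 ++ R ∧ q₂.length = R.length ∧ R.head? ≠ some 0 := by
    have hle : leadingZeros r ≤ r.length := (List.takeWhile_prefix _).length_le
    refine ⟨q.take (leadingZeros r), q.drop (leadingZeros r), r.drop (leadingZeros r),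
      (List.take_append_drop _ _).symm, ?_, by simp [h], head?_drop_leadingZeros r⟩
    rw [List.length_take, h, min_eq_left hle]
    exact eq_replicate_append r
  have hq := fun σ => fReg_eq_coreSum q₁ q₂ hR ρ σ
  rw [hq σ]
  -- if `r` vanishes, the new entry `b` either extends the leading zeros or ends them
  rcases eq_or_ne R [] with rfl | hne
  · obtain rfl : q₂ = [] := by simpa using h₂
    rcases eq_or_ne b 0 with rfl | hb
    · have heq : fReg (q₁ ++ [] ++ [a]) (List.replicate q₁.length 0 ++ [] ++ [0]) ρ =
          fun σ : ℝ => (B (q₁ ++ [a]) : ℂ) * (Complex.I * σ) ^ (q₁.sum + a + q₁.length + 1) := by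
        ext θ
        have := fReg_eq_coreSum (q₁ ++ [a]) [] (R := []) (by simp) ρ θ
        rw [merge, coreSum_nil] at this
        simpa [List.replicate_succ', add_assoc] using this
      rw [heq]
      have hx : HasDerivAt (fun σ : ℝ => Complex.I * (σ : ℂ)) Complex.I σ := by
        simpa using (Complex.ofRealCLM.hasDerivAt (x := σ)).const_mul Complex.I
      refine ((hx.pow (q₁.sum + a + q₁.length + 1)).const_mul (B (q₁ ++ [a]) : ℂ)).congr_deriv ?_
      have hne : (q₁.sum + a + q₁.length + 1 : ℂ) ≠ 0 := by
        exact_mod_cast Nat.succ_ne_zero (q₁.sum + a + q₁.length)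
      rw [B_concat, merge, coreSum_nil]
      rw [Nat.add_sub_cancel, List.sum_nil, add_zero, pow_zero, mul_one,
        show q₁.sum + a + q₁.length = a + (q₁.sum + q₁.length) by ring, pow_add]
      generalize q₁.sum = s at hne ⊢
      push_cast
      field_simp
      ring
    · have hb' : ([b] : List ℕ).head? ≠ some 0 := by simpa using hb
      have heq : fReg (q₁ ++ [] ++ [a]) (List.replicate q₁.length 0 ++ [] ++ [b]) ρ =
          fun σ : ℝ => (B q₁ : ℂ) *
            coreSum ([] ++ [q₁.sum + q₁.length + a]) ([] ++ [b])
              ([].sum + (q₁.sum + q₁.length + a)) ρ σ := by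
        ext θ
        have := fReg_eq_coreSum q₁ [a] hb' ρ θ
        rw [merge] at this
        simpa [add_assoc, add_comm, add_left_comm] using this
      rw [heq]
      refine ((hasDerivAt_coreSum h0 h1 (Q := []) (R := []) (q₁.sum + q₁.length + a) b rfl
        (by simpa using hb) σ).const_mul (B q₁ : ℂ)).congr_deriv ?_
      rw [merge, coreSum_nil, coreSum_nil]
      simp only [List.sum_nil, pow_zero, pow_add, add_zero]
      ring
  · have hR' : (R ++ [b]).head? ≠ some 0 := by rwa [List.head?_append_of_ne_nil _ hne]
    obtain ⟨c, t, rfl⟩ : ∃ c t, q₂ = c :: t :=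
      List.exists_cons_of_ne_nil (by rintro rfl; exact hne (List.length_eq_zero_iff.1 h₂.symm))
    have heq : fReg (q₁ ++ c :: t ++ [a]) (List.replicate q₁.length 0 ++ R ++ [b]) ρ =
        fun σ : ℝ => (B q₁ : ℂ) *
          coreSum (merge q₁ (c :: t) ++ [a]) (R ++ [b]) ((merge q₁ (c :: t)).sum + a) ρ σ := by
      ext θ
      have := fReg_eq_coreSum q₁ (c :: t ++ [a]) hR' ρ θ
      rw [List.append_assoc, List.append_assoc, this]
      simp only [merge, List.cons_append, List.sum_cons, List.sum_append]
      congr 2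
      simp
      ring
    rw [heq]
    refine ((hasDerivAt_coreSum h0 h1 a b (by simpa [merge] using h₂) hR' σ).const_mul
      (B q₁ : ℂ)).congr_deriv ?_
    have : (merge q₁ (c :: t)).sum = q₁.sum + (c :: t).sum + q₁.length := by
      simp [merge]; ring
    rw [this]
    ring

/-! ### Recursion for `F` on the first block -/

/-- The summand of `F` for the cut with the given block lengths. -/
def cutTerm (blocks : List ℕ) (q r : List ℕ) (σ : ℝ) : ℂ :=
  let h := blocks.length
  let Q : ℕ → List ℕ := fun j => (q.splitWrtCompositionAux blocks).getD j []
  let R : ℕ → List ℕ := fun j => (r.splitWrtCompositionAux blocks).getD j []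
  (-1) ^ (h - 1) * (∏ j ∈ Finset.range (h - 1), f (Q j) (R j) 0)
    * (f (Q (h - 1)) (R (h - 1)) σ - f (Q (h - 1)) (R (h - 1)) 0)

theorem cutTerm_singleton (m : ℕ) (q r : List ℕ) (σ : ℝ) :
    cutTerm [m] q r σ = f (q.take m) (r.take m) σ - f (q.take m) (r.take m) 0 := by
  simp [cutTerm, List.splitWrtCompositionAux_cons]

theorem cutTerm_cons (m : ℕ) {t : List ℕ} (ht : t ≠ []) (q r : List ℕ) (σ : ℝ) :
    cutTerm (m :: t) q r σ =
      -f (q.take m) (r.take m) 0 * cutTerm t (q.drop m) (r.drop m) σ := by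
  obtain ⟨b, t, rfl⟩ := List.exists_cons_of_ne_nil ht
  simp only [cutTerm, List.length_cons, Nat.add_sub_cancel, List.splitWrtCompositionAux_cons _ m]
  rw [Finset.prod_range_succ', pow_succ]
  simp only [List.getD_cons_succ, List.getD_cons_zero]
  ring

theorem F_nil (r : List ℕ) (σ : ℝ) : F [] r σ = 1 := by simp [F]

theorem F_eq_sum_cutTerm {q : List ℕ} (hq : q ≠ []) {n : ℕ} (hn : q.length = n) (r : List ℕ) (σ : ℝ) :
    F q r σ = ∑ c : Composition n, cutTerm c.blocks q r σ := by
  subst hn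
  rw [F, if_neg hq]
  rfl

/-- A composition of a positive integer is its first block followed by a composition of the rest. -/
theorem sum_composition_eq {M : Type*} [AddCommMonoid M] {n : ℕ} (hn : 0 < n) (g : List ℕ → M) :
    ∑ c : Composition n, g c.blocks =
      ∑ m ∈ Finset.range n, ∑ c : Composition (n - (m + 1)), g ((m + 1) :: c.blocks) := by
  rw [Finset.sum_sigma']
  symm
  refine Finset.sum_bij (fun x hx => ⟨(x.1 + 1) :: x.2.blocks, ?_, ?_⟩) ?_ ?_ ?_ ?_
  · intro i hi
    rcases List.mem_cons.1 hi with rfl | hi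
    · exact Nat.succ_pos _
    · exact x.2.blocks_pos hi
  · have := Finset.mem_range.1 (Finset.mem_sigma.1 hx).1
    rw [List.sum_cons, x.2.blocks_sum]
    omega
  · intro _ _
    exact Finset.mem_univ _
  · rintro ⟨m, c⟩ _ ⟨m', c'⟩ _ h
    have h' := congrArg Composition.blocks h
    simp only [List.cons.injEq, Nat.add_right_cancel_iff] at h'
    obtain ⟨rfl, h2⟩ := h'
    obtain rfl : c = c' := Composition.ext h2
    rfl
  · intro c _
    rcases hc : c.blocks with _ | ⟨b, t⟩
    · have := c.blocks_sum
      rw [hc] at this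
      simp at this
      omega
    have hb : 0 < b := c.blocks_pos (by rw [hc]; simp)
    have hs : b + t.sum = n := by rw [← c.blocks_sum, hc, List.sum_cons]
    have ht : ∀ {i}, i ∈ t → 0 < i := fun hi => c.blocks_pos (by rw [hc]; simp [hi])
    refine ⟨⟨b - 1, ⟨t, ht, by omega⟩⟩, ?_, ?_⟩
    · simp; omega
    · ext1
      simp [hc]
      omega
  · intro _ _
    rfl

/-- The cuts with a single block give the first two terms; the others are grouped by their first
block, of length `m + 1`. -/
theorem F_eq_sub_sum {n : ℕ} {q r : List ℕ} (hq : q.length = n + 1) (hr : r.length = n + 1) (σ : ℝ) :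
    F q r σ = f q r σ - f q r 0 - ∑ m ∈ Finset.range n,
      f (q.take (m + 1)) (r.take (m + 1)) 0 * F (q.drop (m + 1)) (r.drop (m + 1)) σ := by
  have hne : q ≠ [] := by rintro rfl; simp at hq
  rw [F_eq_sum_cutTerm hne hq, sum_composition_eq n.succ_pos fun t => cutTerm t q r σ,
    Finset.sum_range_succ, add_comm, sub_eq_add_neg, ← Finset.sum_neg_distrib]
  congr 1
  · have h0 : ∀ c : Composition (n + 1 - (n + 1)), c.blocks = [] := by
      intro c
      have h1 : c.blocks.sum = 0 := c.blocks_sum.trans (Nat.sub_self _)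
      by_contra hc
      obtain ⟨b, t, hbt⟩ := List.exists_cons_of_ne_nil hc
      have := c.blocks_pos (i := b) (by rw [hbt]; simp)
      rw [hbt, List.sum_cons] at h1
      omega
    simp only [h0, cutTerm_singleton]
    rw [List.take_of_length_le hq.le, List.take_of_length_le hr.le, Finset.sum_const,
      Finset.card_univ, composition_card]
    simp
  · refine Finset.sum_congr rfl fun m hm => ?_
    have hm := Finset.mem_range.1 hm
    have hl : (q.drop (m + 1)).length = n + 1 - (m + 1) := by rw [List.length_drop, hq]
    have hne' : q.drop (m + 1) ≠ [] := by
      intro h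
      rw [h, List.length_nil] at hl
      omega
    rw [F_eq_sum_cutTerm hne' hl, ← neg_mul, Finset.mul_sum]
    refine Finset.sum_congr rfl fun c _ => cutTerm_cons _ ?_ _ _ _
    intro h
    have := c.blocks_sum
    rw [h, List.sum_nil] at this
    omega

theorem continuous_F {q r : List ℕ} (h : q.length = r.length) : Continuous (F q r) := by
  induction hn : q.length using Nat.strong_induction_on generalizing q r with
  | _ n ih =>
    rcases n with _ | n
    · obtain rfl := List.length_eq_zero_iff.1 hn
      have : F [] r = fun _ => 1 := funext (F_nil r)
      rw [this]
      exact continuous_const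
    · have : F q r = fun σ => f q r σ - f q r 0 - ∑ m ∈ Finset.range n,
          f (q.take (m + 1)) (r.take (m + 1)) 0 * F (q.drop (m + 1)) (r.drop (m + 1)) σ :=
        funext (F_eq_sub_sum hn (h ▸ hn))
      rw [this]
      refine ((continuous_f h).sub continuous_const).sub (continuous_finsetSum _ fun m hm => ?_)
      have hm := Finset.mem_range.1 hm
      exact continuous_const.mul (ih (n - m) (by omega) (by simp [h]) (by simp [hn]))

/-! ### Coefficients in `ℚ(i)` -/

/-- The space of the linear combinations over `ℚ(i)` of the functions `σ ^ a ζ ⋯ ζ Li(e^{iσ})`. -/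
abbrev elementarySpan : Submodule QI (Set.Icc (0 : ℝ) (2 * Real.pi) → ℂ) :=
  Submodule.span QI elementaryProducts

/-- The constants that preserve the space of elementary functions. -/
def IsMultiplier (c : ℂ) : Prop := ∀ g ∈ elementarySpan, (fun σ => c * g σ) ∈ elementarySpan

theorem IsMultiplier.mul {c d : ℂ} (hc : IsMultiplier c) (hd : IsMultiplier d) :
    IsMultiplier (c * d) := fun g hg => by
  simpa only [mul_assoc] using hc _ (hd g hg)

theorem IsMultiplier.add {c d : ℂ} (hc : IsMultiplier c) (hd : IsMultiplier d) :
    IsMultiplier (c + d) := fun g hg => by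
  simp only [add_mul]
  exact add_mem (hc g hg) (hd g hg)

theorem isMultiplier_of_mem {c : ℂ} (hc : c ∈ QI) : IsMultiplier c := fun _ hg =>
  Submodule.smul_mem elementarySpan (⟨c, hc⟩ : QI) hg

theorem rat_mem_QI (c : ℚ) : (c : ℂ) ∈ QI := QI.algebraMap_mem c

theorem I_mem_QI : Complex.I ∈ QI := IntermediateField.mem_adjoin_simple_self ℚ Complex.I

theorem isMultiplier_sum {ι : Type*} (s : Finset ι) (c : ι → ℂ) (h : ∀ i ∈ s, IsMultiplier (c i)) :
    IsMultiplier (∑ i ∈ s, c i) := by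
  induction s using Finset.cons_induction with
  | empty => simpa using isMultiplier_of_mem (zero_mem QI)
  | cons a s ha ih =>
    rw [Finset.sum_cons]
    exact (h a (by simp)).add (ih fun i hi => h i (by simp [hi]))

theorem isMultiplier_mzv {k : List ℕ} (hk : Admissible k) : IsMultiplier (mzv k : ℂ) := by
  intro g hg
  induction hg using Submodule.span_induction with
  | mem g hg =>
    obtain ⟨a, ks, m, h1, h2, rfl⟩ := hg
    refine Submodule.subset_span ⟨a, k :: ks, m, ?_, h2, ?_⟩
    · simpa using ⟨hk, h1⟩
    · funext σ
      simp only [List.map_cons, List.prod_cons]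
      ring
  | zero =>
    simp only [Pi.zero_apply, mul_zero]
    exact zero_mem elementarySpan
  | add x y _ _ hx hy =>
    simp only [Pi.add_apply, mul_add]
    exact add_mem hx hy
  | smul c x _ hx =>
    simp only [Pi.smul_apply, mul_smul_comm]
    exact Submodule.smul_mem elementarySpan c hx

theorem isMultiplier_L_one {x : H} (hx : x ∈ admSpan) : IsMultiplier (L 1 x) := by
  induction hx using Submodule.span_induction with
  | mem x hx =>
    obtain ⟨w, hw, rfl⟩ := hx
    rw [L_word_of_proper 1 hw.1, multiLi_one]
    exact isMultiplier_mzv hw.admissible_decode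
  | zero => simpa using isMultiplier_of_mem (zero_mem QI)
  | add x y _ _ hx hy => simpa using hx.add hy
  | smul c x _ hx =>
    rw [map_smul, ← Rat.cast_smul_eq_qsmul ℂ c, smul_eq_mul]
    exact (isMultiplier_of_mem (rat_mem_QI c)).mul hx

theorem isMultiplier_f_zero {q r : List ℕ} (h : q.length = r.length) : IsMultiplier (f q r 0) := by
  simp only [f]
  refine (isMultiplier_of_mem (rat_mem_QI _)).mul (isMultiplier_sum _ _ fun j hj => ?_)
  refine ((isMultiplier_of_mem (rat_mem_QI _)).mul (isMultiplier_of_mem ?_)).mul ?_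
  · simpa using pow_mem (zero_mem QI) _
  · simpa using isMultiplier_L_one (w_bar_mem_admSpan h hj)

theorem one_mem_elementarySpan : (fun _ => 1 : Set.Icc (0 : ℝ) (2 * Real.pi) → ℂ) ∈ elementarySpan :=
  Submodule.subset_span ⟨0, [], [], by simp, by simp [Admissible], by simp [multiLi]⟩

theorem pow_mul_L_mem_elementarySpan (N : ℕ) {x : H} (hx : x ∈ admSpan) :
    (fun σ : Set.Icc (0 : ℝ) (2 * Real.pi) => ((σ : ℝ) : ℂ) ^ N *
      L (Complex.exp (Complex.I * ((σ : ℝ) : ℂ))) x) ∈ elementarySpan := by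
  induction hx using Submodule.span_induction with
  | mem x hx =>
    obtain ⟨w, hw, rfl⟩ := hx
    refine Submodule.subset_span ⟨N, [], (decode w).2, by simp, hw.admissible_decode, ?_⟩
    funext σ
    simp [L_word_of_proper _ hw.1]
  | zero =>
    simp only [map_zero, mul_zero]
    exact zero_mem elementarySpan
  | add x y _ _ hx hy =>
    simp only [map_add, mul_add]
    exact add_mem hx hy
  | smul c x _ hx =>
    simp only [map_smul, ← Rat.cast_smul_eq_qsmul ℂ c, smul_eq_mul, mul_left_comm _ (c : ℂ)]
    exact isMultiplier_of_mem (rat_mem_QI c) _ hx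

theorem f_mem_elementarySpan {q r : List ℕ} (h : q.length = r.length) :
    (fun σ : Set.Icc (0 : ℝ) (2 * Real.pi) => f q r σ) ∈ elementarySpan := by
  simp only [f]
  refine isMultiplier_of_mem (rat_mem_QI _) _ ?_
  have key : ∀ j ∈ precFinset (bar (leadingZeros r) q),
      (fun σ : Set.Icc (0 : ℝ) (2 * Real.pi) => (C (bar (leadingZeros r) q) j : ℂ) *
        (Complex.I * (σ : ℝ)) ^ (q.sum + leadingZeros r - j.sum) *
        L (Complex.exp (Complex.I * (σ : ℝ))) (w j (r.drop (leadingZeros r)))) ∈ elementarySpan := by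
    intro j hj
    simp only [mul_pow, mul_assoc]
    exact isMultiplier_of_mem (rat_mem_QI _) _ (isMultiplier_of_mem (pow_mem I_mem_QI _) _
      (pow_mul_L_mem_elementarySpan _ (w_bar_mem_admSpan h hj)))
  convert sum_mem key using 1
  funext σ
  rw [Finset.sum_apply]

theorem F_mem_elementarySpan {q r : List ℕ} (h : q.length = r.length) :
    (fun σ : Set.Icc (0 : ℝ) (2 * Real.pi) => F q r σ) ∈ elementarySpan := by
  induction hn : q.length using Nat.strong_induction_on generalizing q r with
  | _ n ih =>
    rcases n with _ | n
    · obtain rfl := List.length_eq_zero_iff.1 hn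
      simp only [F_nil]
      exact one_mem_elementarySpan
    · simp only [fun σ => F_eq_sub_sum hn (h ▸ hn) σ]
      have h0 : (fun _ => f q r 0 : Set.Icc (0 : ℝ) (2 * Real.pi) → ℂ) ∈ elementarySpan := by
        simpa using isMultiplier_f_zero h _ one_mem_elementarySpan
      have key : ∀ m ∈ Finset.range n, (fun σ : Set.Icc (0 : ℝ) (2 * Real.pi) =>
          f (q.take (m + 1)) (r.take (m + 1)) 0 * F (q.drop (m + 1)) (r.drop (m + 1)) σ) ∈
            elementarySpan := by
        intro m hm
        have hm := Finset.mem_range.1 hm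
        exact isMultiplier_f_zero (by simp [h]) _
          (ih (n - m) (by omega) (by simp [h]) (by simp [hn]))
      convert sub_mem (sub_mem (f_mem_elementarySpan h) h0) (sum_mem key) using 1
      funext σ
      simp only [Pi.sub_apply, Finset.sum_apply]

section

open MeasureTheory

/-! ### The function `log (1 - e^{iθ})` -/

theorem one_sub_exp_eq (θ : ℝ) : 1 - Complex.exp (Complex.I * θ) =
    (2 * Real.sin (θ / 2) : ℝ) * Complex.exp (Complex.I * ((θ - Real.pi) / 2 : ℝ)) := by
  have h : (θ - Real.pi) / 2 = θ / 2 - Real.pi / 2 := by ring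
  rw [h, mul_comm Complex.I, mul_comm Complex.I, Complex.exp_mul_I, Complex.exp_mul_I,
    ← Complex.ofReal_cos, ← Complex.ofReal_cos, ← Complex.ofReal_sin, ← Complex.ofReal_sin,
    Real.cos_sub_pi_div_two, Real.sin_sub_pi_div_two]
  have h1 : Real.cos θ = 1 - 2 * Real.sin (θ / 2) ^ 2 := by
    rw [show θ = 2 * (θ / 2) by ring, Real.cos_two_mul']
    have := Real.sin_sq_add_cos_sq (θ / 2)
    rw [show 2 * (θ / 2) / 2 = θ / 2 by ring]
    linarith
  have h2 : Real.sin θ = 2 * Real.sin (θ / 2) * Real.cos (θ / 2) := by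
    rw [← Real.sin_two_mul]; congr 1; ring
  rw [h1, h2]
  push_cast
  ring

theorem norm_one_sub_exp (θ : ℝ) : ‖1 - Complex.exp (Complex.I * θ)‖ = |2 * Real.sin (θ / 2)| := by
  rw [one_sub_exp_eq, norm_mul, norm_exp_I_mul, mul_one, Complex.norm_real, Real.norm_eq_abs]

theorem sin_half_pos {θ : ℝ} (h : θ ∈ Set.Ioo 0 (2 * Real.pi)) : 0 < Real.sin (θ / 2) :=
  Real.sin_pos_of_pos_of_lt_pi (by linarith [h.1]) (by linarith [h.2])

theorem A_eq_of_mem_Ioo {θ : ℝ} (h : θ ∈ Set.Ioo 0 (2 * Real.pi)) :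
    (A θ : ℂ) = -(-Complex.log (1 - Complex.exp (Complex.I * θ)) + Complex.I * θ / 2 -
      Complex.I * Real.pi / 2) := by
  have hs : 0 < 2 * Real.sin (θ / 2) := by linarith [sin_half_pos h]
  have h1 : 1 - Complex.exp (Complex.I * θ) =
      Complex.exp ((A θ : ℂ) + Complex.I * ((θ - Real.pi) / 2 : ℝ)) := by
    rw [one_sub_exp_eq, Complex.exp_add, ← Complex.ofReal_exp, A, abs_of_pos hs, Real.exp_log hs]
  have him : ((A θ : ℂ) + Complex.I * ((θ - Real.pi) / 2 : ℝ)).im = (θ - Real.pi) / 2 := by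
    simp
  rw [h1, Complex.log_exp]
  · push_cast; ring
  · rw [him]; linarith [h.1, Real.pi_pos]
  · rw [him]; linarith [h.2, Real.pi_pos]

theorem measurable_A : Measurable A := by
  unfold A
  exact Real.measurable_log.comp (by fun_prop)

theorem A_two_pi_sub (θ : ℝ) : A (2 * Real.pi - θ) = A θ := by
  rw [A, A, show (2 * Real.pi - θ) / 2 = Real.pi - θ / 2 by ring, Real.sin_pi_sub]

theorem abs_A_le {θ : ℝ} (h0 : 0 < θ) (h1 : θ ≤ Real.pi) : |A θ| ≤ |Real.log θ| + 1 := by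
  have hs := sin_half_pos ⟨h0, by linarith [Real.pi_pos]⟩
  have hs1 := Real.sin_le_one (θ / 2)
  have hs2 : 2 / Real.pi * (θ / 2) ≤ Real.sin (θ / 2) :=
    Real.mul_le_sin (by linarith) (by linarith)
  have hpi := Real.pi_pos
  rw [A, abs_of_pos (by linarith : 0 < 2 * Real.sin (θ / 2)), abs_le]
  constructor
  · have h2 : Real.log (2 / Real.pi * θ) ≤ Real.log (2 * Real.sin (θ / 2)) :=
      Real.log_le_log (by positivity) (by linarith)
    have h3 : Real.log (2 / Real.pi * θ) = -Real.log (Real.pi / 2) + Real.log θ := by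
      rw [Real.log_mul (by positivity) h0.ne', ← Real.log_inv, inv_div]
    have h4 : Real.log (Real.pi / 2) ≤ Real.pi / 2 - 1 := Real.log_le_sub_one_of_pos (by positivity)
    linarith [neg_abs_le (Real.log θ), Real.pi_lt_four]
  · have h2 : Real.log (2 * Real.sin (θ / 2)) ≤ 2 * Real.sin (θ / 2) - 1 :=
      Real.log_le_sub_one_of_pos (by linarith)
    linarith [abs_nonneg (Real.log θ)]

/-- All powers of `log |2 sin (θ / 2)|` are integrable: near `0` the function is as large as `log θ`,
and `exp (|log θ| / 2)` is integrable. -/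
theorem intervalIntegrable_A_pow (c : ℝ) (K : ℕ) :
    IntervalIntegrable (fun θ => (|A θ| + |c|) ^ K) volume 0 (2 * Real.pi) := by
  have hpi := Real.pi_pos
  have hmeas : Measurable fun θ => (|A θ| + |c|) ^ K := by
    have := measurable_A
    exact ((continuous_abs.measurable.comp this).add_const _).pow_const K
  have half : IntervalIntegrable (fun θ => (|A θ| + |c|) ^ K) volume 0 Real.pi := by
    have hb : IntervalIntegrable (fun θ : ℝ => 2 ^ K * K.factorial * Real.exp ((1 + |c|) / 2) *
        (θ ^ (1 / 2 : ℝ) + θ ^ (-1 / 2 : ℝ))) volume 0 Real.pi :=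
      ((intervalIntegral.intervalIntegrable_rpow' (by norm_num)).add
        (intervalIntegral.intervalIntegrable_rpow' (by norm_num))).const_mul _
    refine hb.mono_fun' hmeas.aestronglyMeasurable ?_
    rw [Set.uIoc_of_le hpi.le]
    refine (ae_restrict_mem measurableSet_Ioc).mono fun θ hθ => ?_
    have hy : 0 ≤ (|A θ| + |c|) / 2 := by positivity
    have h1 := Real.pow_div_factorial_le_exp _ hy K
    rw [div_le_iff₀ (by positivity), div_pow, div_le_iff₀ (by positivity)] at h1
    dsimp only
    rw [Real.norm_of_nonneg (by positivity)]
    refine h1.trans ?_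
    have h2 : Real.exp ((|A θ| + |c|) / 2) ≤
        Real.exp ((1 + |c|) / 2) * Real.exp (|Real.log θ| / 2) := by
      rw [← Real.exp_add]
      exact Real.exp_le_exp.2 (by linarith [abs_A_le hθ.1 hθ.2])
    have h3 : Real.exp (|Real.log θ| / 2) ≤ θ ^ (1 / 2 : ℝ) + θ ^ (-1 / 2 : ℝ) := by
      rw [Real.rpow_def_of_pos hθ.1, Real.rpow_def_of_pos hθ.1]
      rcases abs_cases (Real.log θ) with ⟨h, -⟩ | ⟨h, -⟩
      · rw [h, div_eq_mul_one_div]; linarith [Real.exp_pos (Real.log θ * (-1 / 2))]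
      · rw [h, show -Real.log θ / 2 = Real.log θ * (-1 / 2) by ring]
        linarith [Real.exp_pos (Real.log θ * (1 / 2))]
    calc _ ≤ Real.exp ((1 + |c|) / 2) * (θ ^ (1 / 2 : ℝ) + θ ^ (-1 / 2 : ℝ)) * K.factorial * 2 ^ K := by
          gcongr
          exact h2.trans (by gcongr)
      _ = _ := by ring
  refine half.trans ?_
  have := (half.comp_sub_left (2 * Real.pi)).symm
  rw [show 2 * Real.pi - Real.pi = Real.pi by ring, sub_zero] at this
  simpa only [A_two_pi_sub] using this

/-- A bound for the logarithm that is uniform in the radius; the constant `6` is an upper bound for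
`π + 1`. -/
theorem norm_log_le {θ ρ : ℝ} (hθ : θ ∈ Set.Ioo 0 (2 * Real.pi)) (h0 : 0 ≤ ρ) (h1 : ρ ≤ 1) :
    ‖-Complex.log (1 - ρ * Complex.exp (Complex.I * θ))‖ ≤ |A θ| + |6| := by
  set z := Complex.exp (Complex.I * θ) with hz
  have hz1 : ‖z‖ = 1 := norm_exp_I_mul θ
  have hA : A θ = Real.log ‖1 - z‖ := by rw [norm_one_sub_exp, A]
  have hpos : 0 < ‖1 - z‖ := by
    rw [norm_one_sub_exp]
    exact abs_pos.2 (by linarith [sin_half_pos hθ])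
  have hρz : ‖(ρ : ℂ) * z‖ = ρ := by
    rw [norm_mul, hz1, mul_one, Complex.norm_real, Real.norm_of_nonneg h0]
  have hle : ‖1 - (ρ : ℂ) * z‖ ≤ 2 := by
    refine (norm_sub_le _ _).trans ?_
    rw [hρz, norm_one]; linarith
  -- the point `ρ z` is at most as far from `z` as from `1`, hence `|1 - z| ≤ 2 |1 - ρ z|`
  have hge : ‖1 - z‖ / 2 ≤ ‖1 - (ρ : ℂ) * z‖ := by
    have e1 : 1 - z = (1 - ρ * z) - (1 - ρ : ℝ) * z := by push_cast; ring
    have e2 : ‖((1 - ρ : ℝ) : ℂ) * z‖ = 1 - ρ := by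
      rw [norm_mul, hz1, mul_one, Complex.norm_real, Real.norm_of_nonneg (by linarith)]
    have e3 : 1 - ρ ≤ ‖1 - (ρ : ℂ) * z‖ := by
      have := norm_sub_norm_le 1 ((ρ : ℂ) * z)
      rwa [hρz, norm_one] at this
    have e4 : ‖1 - z‖ ≤ ‖1 - (ρ : ℂ) * z‖ + ‖((1 - ρ : ℝ) : ℂ) * z‖ := by
      rw [e1]; exact norm_sub_le _ _
    linarith
  rw [norm_neg]
  refine (Complex.norm_le_abs_re_add_abs_im _).trans ?_
  rw [Complex.log_re, Complex.log_im, hA]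
  have h2 := Complex.abs_arg_le_pi (1 - (ρ : ℂ) * z)
  have h3 : |Real.log ‖1 - (ρ : ℂ) * z‖| ≤ |Real.log ‖1 - z‖| + 1 := by
    have hp : 0 < ‖1 - (ρ : ℂ) * z‖ := by linarith
    rw [abs_le]
    constructor
    · have := Real.log_le_log (by positivity) hge
      rw [Real.log_div hpos.ne' two_ne_zero] at this
      linarith [neg_abs_le (Real.log ‖1 - z‖), Real.log_two_lt_d9]
    · have := Real.log_le_log hp hle
      linarith [abs_nonneg (Real.log ‖1 - z‖), Real.log_two_lt_d9]
  rw [abs_of_pos (by norm_num : (0 : ℝ) < 6)]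
  linarith [Real.pi_lt_four]

/-! ### The integral equation -/

/-- The density of the form `(iθ)^a Li₁(e^{iθ})^b i dθ`, where `Li₁(z) = -log (1 - z)`. -/
def phi (a b : ℕ) (θ : ℝ) : ℂ :=
  Complex.I * (Complex.I * θ) ^ a * (-Complex.log (1 - Complex.exp (Complex.I * θ))) ^ b

theorem measurable_phi (a b : ℕ) : Measurable (phi a b) := by
  unfold phi
  have : Measurable fun θ : ℝ => 1 - Complex.exp (Complex.I * θ) := by fun_prop
  exact (by fun_prop : Measurable fun θ : ℝ => Complex.I * (Complex.I * (θ : ℂ)) ^ a).mul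
    ((Complex.measurable_log.comp this).neg.pow_const b)

theorem norm_form_le (a b : ℕ) {θ ρ : ℝ} (hθ : θ ∈ Set.Ioo 0 (2 * Real.pi)) (h0 : 0 ≤ ρ)
    (h1 : ρ ≤ 1) :
    ‖Complex.I * (Complex.I * θ) ^ a * (-Complex.log (1 - ρ * Complex.exp (Complex.I * θ))) ^ b‖ ≤
      (2 * Real.pi) ^ a * (|A θ| + |6|) ^ b := by
  rw [norm_mul, norm_mul, norm_pow, norm_mul, Complex.norm_I, one_mul, one_mul, norm_pow,
    Complex.norm_real, Real.norm_of_nonneg hθ.1.le]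
  have := norm_log_le hθ h0 h1
  have := hθ.2.le
  have := hθ.1.le
  gcongr

/-- The endpoint `θ = 2π`, a singularity of the integrands, can be ignored. -/
theorem ae_mem_Ioo {σ : ℝ} (hσ : σ ∈ Set.Icc 0 (2 * Real.pi)) :
    ∀ᵐ θ : ℝ, θ ∈ Set.uIoc 0 σ → θ ∈ Set.Ioo 0 (2 * Real.pi) := by
  refine (measure_eq_zero_iff_ae_notMem.1 (measure_singleton (2 * Real.pi))).mono fun θ h hθ => ?_
  rw [Set.uIoc_of_le hσ.1] at hθ
  exact ⟨hθ.1, lt_of_le_of_ne (hθ.2.trans hσ.2) h⟩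

theorem intervalIntegrable_phi (a b : ℕ) : IntervalIntegrable (phi a b) volume 0 (2 * Real.pi) := by
  refine ((intervalIntegrable_A_pow 6 b).const_mul ((2 * Real.pi) ^ a)).mono_fun'
    (measurable_phi a b).aestronglyMeasurable ?_
  refine (ae_restrict_iff' measurableSet_uIoc).2 ((ae_mem_Ioo
    ⟨by positivity, le_rfl⟩).mono fun θ h hθ => ?_)
  have := norm_form_le a b (h hθ) zero_le_one le_rfl
  rwa [Complex.ofReal_one, one_mul] at this

theorem intervalIntegrable_restrict {E : Type*} [NormedAddCommGroup E] {g : ℝ → E}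
    (hg : IntervalIntegrable g volume 0 (2 * Real.pi)) {σ : ℝ}
    (hσ : σ ∈ Set.Icc 0 (2 * Real.pi)) : IntervalIntegrable g volume 0 σ :=
  hg.mono_set (by
    rw [Set.uIcc_of_le hσ.1, Set.uIcc_of_le (by positivity)]
    exact Set.Icc_subset_Icc le_rfl hσ.2)

theorem fReg_sub_eq_integral {q r : List ℕ} (h : q.length = r.length) (a b : ℕ) {ρ : ℝ}
    (h0 : 0 ≤ ρ) (h1 : ρ < 1) (σ : ℝ) :
    fReg (q ++ [a]) (r ++ [b]) ρ σ - fReg (q ++ [a]) (r ++ [b]) ρ 0 =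
      ∫ θ in (0)..σ, Complex.I * (Complex.I * θ) ^ a *
        (-Complex.log (1 - ρ * Complex.exp (Complex.I * θ))) ^ b * fReg q r ρ θ := by
  symm
  refine intervalIntegral.integral_eq_sub_of_hasDerivAt (fun θ _ => ?_)
    (Continuous.intervalIntegrable ?_ _ _)
  · rw [← polylog_e_one (norm_mul_exp_lt_one h0 h1 θ)]
    exact hasDerivAt_fReg h0 h1 a b h θ
  · have hlog : Continuous fun θ : ℝ => Complex.log (1 - ρ * Complex.exp (Complex.I * θ)) := by
      refine Continuous.clog (by fun_prop) fun θ => ?_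
      rw [sub_eq_add_neg]
      exact Complex.mem_slitPlane_of_norm_lt_one ((norm_neg _).trans_lt (norm_mul_exp_lt_one h0 h1 θ))
    have hf : Continuous fun θ : ℝ => fReg q r ρ θ :=
      (continuousOn_fReg h).comp_continuous (f := fun θ => (ρ, θ)) (by fun_prop)
        fun θ => ⟨⟨h0, h1.le⟩, trivial⟩
    fun_prop

/-- The integrated differential equation for `f` on the unit circle itself, as the limit `ρ → 1` of
the equation on smaller circles. The integrands are dominated by a power of `|A| + 6`. -/
theorem f_sub_eq_integral {q r : List ℕ} (h : q.length = r.length) (a b : ℕ) {σ : ℝ}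
    (hσ : σ ∈ Set.Icc 0 (2 * Real.pi)) :
    f (q ++ [a]) (r ++ [b]) σ - f (q ++ [a]) (r ++ [b]) 0 = ∫ θ in (0)..σ, phi a b θ * f q r θ := by
  have h' : (q ++ [a]).length = (r ++ [b]).length := by simp [h]
  have hev : ∀ᶠ ρ : ℝ in nhdsWithin 1 (Set.Iio 1), 0 ≤ ρ ∧ ρ < 1 := by
    filter_upwards [self_mem_nhdsWithin, nhdsWithin_le_nhds (Ioi_mem_nhds zero_lt_one)]
      with ρ h1 h2 using ⟨le_of_lt h2, h1⟩
  have hlim : ∀ {q r : List ℕ}, q.length = r.length → ∀ θ : ℝ,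
      Filter.Tendsto (fun ρ => fReg q r ρ θ) (nhdsWithin 1 (Set.Iio 1)) (nhds (f q r θ)) := by
    intro q r hqr θ
    rw [f_eq_fReg hqr]
    have hc := continuousOn_fReg hqr (1, θ) ⟨⟨zero_le_one, le_rfl⟩, trivial⟩
    refine hc.tendsto.comp (f := fun ρ : ℝ => (ρ, θ)) (tendsto_nhdsWithin_iff.2 ⟨?_, ?_⟩)
    · have : Continuous fun ρ : ℝ => (ρ, θ) := by fun_prop
      exact (this.tendsto 1).mono_left nhdsWithin_le_nhds
    · exact hev.mono fun ρ hρ => ⟨⟨hρ.1, hρ.2.le⟩, trivial⟩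
  obtain ⟨M, hM⟩ := (isCompact_Icc.prod isCompact_Icc).exists_bound_of_continuousOn
    ((continuousOn_fReg h).mono (Set.prod_mono_right (Set.subset_univ (Set.Icc 0 (2 * Real.pi)))))
  refine tendsto_nhds_unique ((hlim h' σ).sub (hlim h' 0)) ?_
  have key : Filter.Tendsto (fun ρ : ℝ => ∫ θ in (0)..σ, Complex.I * (Complex.I * θ) ^ a *
        (-Complex.log (1 - ρ * Complex.exp (Complex.I * θ))) ^ b * fReg q r ρ θ)
      (nhdsWithin 1 (Set.Iio 1)) (nhds (∫ θ in (0)..σ, phi a b θ * f q r θ)) := by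
    refine intervalIntegral.tendsto_integral_filter_of_dominated_convergence
      (fun θ => (2 * Real.pi) ^ a * (|A θ| + |6|) ^ b * M) ?_ ?_ ?_ ?_
    · refine hev.mono fun ρ hρ => ?_
      have hf : Continuous fun θ : ℝ => fReg q r ρ θ :=
        (continuousOn_fReg h).comp_continuous (f := fun θ => (ρ, θ)) (by fun_prop)
          fun θ => ⟨⟨hρ.1, hρ.2.le⟩, trivial⟩
      have hm : Measurable fun θ : ℝ => 1 - ρ * Complex.exp (Complex.I * θ) := by fun_prop
      exact (((by fun_prop : Measurable fun θ : ℝ => Complex.I * (Complex.I * (θ : ℂ)) ^ a).mul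
        ((Complex.measurable_log.comp hm).neg.pow_const b)).mul hf.measurable).aestronglyMeasurable
    · refine hev.mono fun ρ hρ => (ae_mem_Ioo hσ).mono fun θ hθ hθ' => ?_
      rw [norm_mul]
      exact mul_le_mul (norm_form_le a b (hθ hθ') hρ.1 hρ.2.le)
        (hM (ρ, θ) ⟨⟨hρ.1, hρ.2.le⟩, ⟨(hθ hθ').1.le, (hθ hθ').2.le⟩⟩) (norm_nonneg _) (by positivity)
    · exact intervalIntegrable_restrict
        (((intervalIntegrable_A_pow 6 b).const_mul ((2 * Real.pi) ^ a)).mul_const M) hσ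
    · refine (ae_mem_Ioo hσ).mono fun θ hθ hθ' => ?_
      refine Filter.Tendsto.mul ?_ (hlim h θ)
      refine Filter.Tendsto.const_mul _ (Filter.Tendsto.pow (Filter.Tendsto.neg ?_) b)
      -- `1 - e^{iθ}` has positive real part, so that `log` is continuous there
      have hslit : 1 - ((1 : ℝ) : ℂ) * Complex.exp (Complex.I * θ) ∈ Complex.slitPlane := by
        left
        have hs := sin_half_pos (hθ hθ')
        rw [Complex.ofReal_one, one_mul, one_sub_exp_eq, Complex.re_ofReal_mul, mul_comm Complex.I,
          Complex.exp_ofReal_mul_I_re, show (θ - Real.pi) / 2 = θ / 2 - Real.pi / 2 by ring,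
          Real.cos_sub_pi_div_two]
        positivity
      have hc : ContinuousAt (fun ρ : ℝ => 1 - (ρ : ℂ) * Complex.exp (Complex.I * θ)) 1 := by
        fun_prop
      have := (hc.clog hslit).tendsto.mono_left (nhdsWithin_le_nhds (s := Set.Iio 1))
      simpa using this
  exact key.congr' (hev.mono fun ρ hρ => (fReg_sub_eq_integral h a b hρ.1 hρ.2 σ).symm)

/-- `F` is the iterated integral of the forms `phi`: the constants subtracted in its definition make
each of the primitives vanish at `0`. -/
theorem F_concat_eq_integral {q r : List ℕ} (h : q.length = r.length) (a b : ℕ) {σ : ℝ}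
    (hσ : σ ∈ Set.Icc 0 (2 * Real.pi)) :
    F (q ++ [a]) (r ++ [b]) σ = ∫ θ in (0)..σ, phi a b θ * F q r θ := by
  have hint : ∀ {g : ℝ → ℂ}, Continuous g →
      IntervalIntegrable (fun θ => phi a b θ * g θ) volume 0 σ := fun hg =>
    (intervalIntegrable_restrict (intervalIntegrable_phi a b) hσ).mul_continuousOn hg.continuousOn
  induction hn : q.length using Nat.strong_induction_on generalizing q r with
  | _ n ih =>
    rw [F_eq_sub_sum (n := n) (by simp [hn]) (by simp [← h, hn]), f_sub_eq_integral h a b hσ]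
    rcases n with _ | n
    · obtain rfl := List.length_eq_zero_iff.1 hn
      obtain rfl := List.length_eq_zero_iff.1 (h ▸ hn)
      simp only [Finset.range_zero, Finset.sum_empty, sub_zero, F_nil]
      refine intervalIntegral.integral_congr fun θ _ => ?_
      simp [f, precFinset_nil, bar, B_nil, C_nil, w_nil, L_one, leadingZeros]
    · have hr : r.length = n + 1 := h ▸ hn
      have hterm : ∀ m ∈ Finset.range n,
          f ((q ++ [a]).take (m + 1)) ((r ++ [b]).take (m + 1)) 0 *
            F ((q ++ [a]).drop (m + 1)) ((r ++ [b]).drop (m + 1)) σ =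
          ∫ θ in (0)..σ, phi a b θ * (f (q.take (m + 1)) (r.take (m + 1)) 0 *
            F (q.drop (m + 1)) (r.drop (m + 1)) θ) := by
        intro m hm
        have hm := Finset.mem_range.1 hm
        rw [List.take_append_of_le_length (by omega), List.take_append_of_le_length (by omega),
          List.drop_append_of_le_length (by omega), List.drop_append_of_le_length (by omega),
          ih (n - m) (by omega) (by simp [h]) (by simp [hn]), ← intervalIntegral.integral_const_mul]
        refine intervalIntegral.integral_congr fun θ _ => ?_
        ring
      have hlast : f ((q ++ [a]).take (n + 1)) ((r ++ [b]).take (n + 1)) 0 *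
            F ((q ++ [a]).drop (n + 1)) ((r ++ [b]).drop (n + 1)) σ =
          ∫ θ in (0)..σ, phi a b θ * f q r 0 := by
        have hF := ih 0 n.succ_pos (q := []) (r := []) rfl rfl
        simp only [List.nil_append, F_nil, mul_one] at hF
        rw [List.take_left' hn, List.take_left' hr, List.drop_left' hn, List.drop_left' hr, hF,
          intervalIntegral.integral_mul_const, mul_comm]
      have hcont : ∀ m ∈ Finset.range n, Continuous fun θ =>
          f (q.take (m + 1)) (r.take (m + 1)) 0 * F (q.drop (m + 1)) (r.drop (m + 1)) θ :=
        fun m _ => continuous_const.mul (continuous_F (by simp [h]))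
      rw [Finset.sum_range_succ, Finset.sum_congr rfl hterm, hlast,
        ← intervalIntegral.integral_finsetSum fun m hm => hint (hcont m hm),
        ← intervalIntegral.integral_add _ (hint continuous_const),
        ← intervalIntegral.integral_sub (hint (continuous_f h))]
      · refine intervalIntegral.integral_congr fun θ _ => ?_
        rw [F_eq_sub_sum hn hr, ← Finset.mul_sum]
        ring
      · have := (hint (continuous_finsetSum _ hcont)).add (hint (g := fun _ => f q r 0) continuous_const)
        simpa only [Finset.mul_sum] using this
      · have := hint (continuous_finsetSum _ hcont)
        simpa only [Finset.mul_sum] using this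

/-! ### Iterated integrals of products -/

/-- The iterated integral of `g_1(θ_1) ⋯ g_n(θ_n)` over `0 < θ_1 < ⋯ < θ_n < σ`. -/
def iterInt : (n : ℕ) → (Fin n → ℝ → ℂ) → ℝ → ℂ
  | 0, _, _ => 1
  | n + 1, g, σ => ∫ θ in (0 : ℝ)..σ, g (Fin.last n) θ * iterInt n (fun u => g u.castSucc) θ

theorem F_eq_iterInt {n : ℕ} (q r : Fin n → ℕ) {σ : ℝ} (hσ : σ ∈ Set.Icc 0 (2 * Real.pi)) :
    F (List.ofFn q) (List.ofFn r) σ = iterInt n (fun u => phi (q u) (r u)) σ := by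
  induction n generalizing σ with
  | zero => simp [F_nil, iterInt]
  | succ n ih =>
    rw [List.ofFn_succ', List.ofFn_succ', List.concat_eq_append, List.concat_eq_append,
      F_concat_eq_integral (by simp) _ _ hσ, iterInt]
    refine intervalIntegral.integral_congr fun θ hθ => ?_
    rw [Set.uIcc_of_le hσ.1] at hθ
    rw [ih _ _ ⟨hθ.1, hθ.2.trans hσ.2⟩]

theorem iteratedIntegral_prod_mul {n : ℕ} (g : Fin n → ℝ → ℝ) (c σ : ℝ) :
    (iteratedIntegral n (fun t => (∏ u, g u (t u)) * c) σ : ℂ) =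
      iterInt n (fun u θ => (g u θ : ℂ)) σ * c := by
  induction n generalizing c σ with
  | zero => simp [iteratedIntegral, iterInt]
  | succ n ih =>
    rw [iteratedIntegral, iterInt, ← intervalIntegral.integral_ofReal,
      ← intervalIntegral.integral_mul_const]
    refine intervalIntegral.integral_congr fun θ _ => ?_
    have := ih (fun u => g u.castSucc) (g (Fin.last n) θ * c) θ
    simp only [Fin.prod_univ_castSucc, Fin.snoc_castSucc, Fin.snoc_last, mul_assoc]
    rw [this]
    push_cast
    ring

theorem continuousOn_iterInt {n : ℕ} {g : Fin n → ℝ → ℂ}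
    (hg : ∀ u, IntervalIntegrable (g u) volume 0 (2 * Real.pi)) :
    ContinuousOn (iterInt n g) (Set.uIcc 0 (2 * Real.pi)) := by
  induction n with
  | zero => exact continuousOn_const
  | succ n ih =>
    refine intervalIntegral.continuousOn_primitive_interval'
      ((hg _).mul_continuousOn (ih fun u => hg _)) Set.left_mem_uIcc

theorem iterInt_congr {n : ℕ} {g g' : Fin n → ℝ → ℂ}
    (h : ∀ u, ∀ θ ∈ Set.Ioo 0 (2 * Real.pi), g u θ = g' u θ) {σ : ℝ}
    (hσ : σ ∈ Set.Icc 0 (2 * Real.pi)) : iterInt n g σ = iterInt n g' σ := by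
  induction n generalizing σ with
  | zero => rfl
  | succ n ih =>
    refine intervalIntegral.integral_congr_ae ((ae_mem_Ioo hσ).mono fun θ hθ hθ' => ?_)
    have := hθ hθ'
    rw [h _ θ this, ih (fun u => h _) ⟨this.1.le, this.2.le⟩]

theorem iterInt_const_mul {n : ℕ} (c : Fin n → ℂ) (g : Fin n → ℝ → ℂ) (σ : ℝ) :
    iterInt n (fun u θ => c u * g u θ) σ = (∏ u, c u) * iterInt n g σ := by
  induction n generalizing σ with
  | zero => simp [iterInt]
  | succ n ih =>
    rw [iterInt, iterInt, ← intervalIntegral.integral_const_mul]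
    refine intervalIntegral.integral_congr fun θ _ => ?_
    rw [ih, Fin.prod_univ_castSucc]
    ring

theorem sum_piFinset_castSucc {ι M : Type*} [DecidableEq ι] [AddCommMonoid M] {n : ℕ}
    (S : Fin (n + 1) → Finset ι) (φ : (Fin (n + 1) → ι) → M) :
    ∑ x ∈ Fintype.piFinset S, φ x =
      ∑ s ∈ S (Fin.last n), ∑ x ∈ Fintype.piFinset fun u : Fin n => S u.castSucc,
        φ (Fin.snoc (α := fun _ => ι) x s) := by
  rw [Finset.sum_sigma']
  refine Finset.sum_bij' (fun x _ => ⟨x (Fin.last n), Fin.init x⟩)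
    (fun y _ => Fin.snoc (α := fun _ => ι) y.2 y.1) ?_ ?_ ?_ ?_ ?_
  · intro x hx
    rw [Fintype.mem_piFinset] at hx
    simp only [Finset.mem_sigma, Fintype.mem_piFinset]
    exact ⟨hx _, fun u => hx _⟩
  · rintro ⟨s, x⟩ h
    simp only [Finset.mem_sigma, Fintype.mem_piFinset] at h
    refine Fintype.mem_piFinset.2 (Fin.forall_fin_succ'.2 ⟨fun u => ?_, ?_⟩)
    · simpa using h.2 u
    · simpa using h.1
  · intro x _
    exact Fin.snoc_init_self x
  · rintro ⟨s, x⟩ _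
    simp
  · intro x _
    simp only [Fin.snoc_init_self]

theorem iterInt_sum {ι : Type*} [DecidableEq ι] {n : ℕ} (S : Fin n → Finset ι)
    (g : Fin n → ι → ℝ → ℂ) (hg : ∀ u s, IntervalIntegrable (g u s) volume 0 (2 * Real.pi)) {σ : ℝ}
    (hσ : σ ∈ Set.Icc 0 (2 * Real.pi)) :
    iterInt n (fun u θ => ∑ s ∈ S u, g u s θ) σ =
      ∑ x ∈ Fintype.piFinset S, iterInt n (fun u => g u (x u)) σ := by
  induction n generalizing σ with
  | zero => simp [iterInt]
  | succ n ih =>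
    have hint : ∀ s (x : Fin n → ι), IntervalIntegrable (fun θ => g (Fin.last n) s θ *
        iterInt n (fun u => g u.castSucc (x u)) θ) volume 0 σ := fun s x =>
      intervalIntegrable_restrict ((hg _ s).mul_continuousOn
        (continuousOn_iterInt fun u => hg _ _)) hσ
    rw [sum_piFinset_castSucc, iterInt]
    simp only [iterInt, Fin.snoc_castSucc, Fin.snoc_last]
    rw [Finset.sum_congr rfl fun s _ =>
      (intervalIntegral.integral_finsetSum fun x _ => hint s x).symm,
      ← intervalIntegral.integral_finsetSum]
    · refine intervalIntegral.integral_congr fun θ hθ => ?_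
      rw [Set.uIcc_of_le hσ.1] at hθ
      rw [ih (fun u => S u.castSucc) (fun u => g u.castSucc) (fun u => hg _)
        ⟨hθ.1, hθ.2.trans hσ.2⟩, Finset.sum_mul]
      simp only [Finset.mul_sum]
    · intro s _
      simpa only [Finset.sum_fn] using
        IntervalIntegrable.sum (Fintype.piFinset fun u : Fin n => S u.castSucc) fun x _ => hint s x

/-! ### The trinomial expansion -/

/-- The triples `(p, q, r)` with `p + q + r = K`. -/
def triples (K : ℕ) : Finset (ℕ × ℕ × ℕ) :=
  (Finset.Iic K ×ˢ Finset.Iic K ×ˢ Finset.Iic K).filter fun x => x.1 + x.2.1 + x.2.2 = K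

theorem mem_triples {K : ℕ} {x : ℕ × ℕ × ℕ} : x ∈ triples K ↔ x.1 + x.2.1 + x.2.2 = K := by
  simp only [triples, Finset.mem_filter, Finset.mem_product, Finset.mem_Iic]
  omega

theorem add_add_pow (x y z : ℂ) (K : ℕ) : (x + y + z) ^ K =
    ∑ t ∈ triples K, (K.factorial : ℂ) / (t.1.factorial * t.2.1.factorial * t.2.2.factorial) *
      (x ^ t.1 * y ^ t.2.1 * z ^ t.2.2) := by
  have hchoose : ∀ p m : ℕ, ((p + m).choose p : ℂ) =
      (p + m).factorial / (p.factorial * m.factorial) := fun p m => Nat.cast_add_choose ℂ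
  have h : ∑ t ∈ triples K, (K.factorial : ℂ) / (t.1.factorial * t.2.1.factorial * t.2.2.factorial) *
      (x ^ t.1 * y ^ t.2.1 * z ^ t.2.2) = ∑ a ∈ Finset.HasAntidiagonal.antidiagonal K,
        ∑ b ∈ Finset.HasAntidiagonal.antidiagonal a.2, (K.factorial : ℂ) /
          (a.1.factorial * b.1.factorial * b.2.factorial) * (x ^ a.1 * y ^ b.1 * z ^ b.2) := by
    rw [Finset.sum_sigma']
    refine Finset.sum_bij' (fun t _ => ⟨(t.1, t.2.1 + t.2.2), (t.2.1, t.2.2)⟩)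
      (fun c _ => (c.1.1, c.2.1, c.2.2)) ?_ ?_ ?_ ?_ ?_
    · intro t ht
      rw [mem_triples] at ht
      simp [← ht, add_assoc]
    · rintro ⟨⟨p, m⟩, ⟨q, r⟩⟩ h
      simp only [Finset.mem_sigma, Finset.HasAntidiagonal.mem_antidiagonal] at h
      rw [mem_triples]
      dsimp only
      omega
    · intro t _
      rfl
    · rintro ⟨⟨p, m⟩, ⟨q, r⟩⟩ h
      simp only [Finset.mem_sigma, Finset.HasAntidiagonal.mem_antidiagonal] at h
      obtain ⟨-, rfl⟩ := h
      rfl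
    · intro t _
      rfl
  rw [h, add_assoc, Commute.add_pow' (Commute.all _ _)]
  refine Finset.sum_congr rfl fun a ha => ?_
  rw [← Finset.HasAntidiagonal.mem_antidiagonal.1 ha, Commute.add_pow' (Commute.all _ _),
    Finset.mul_sum, Finset.smul_sum]
  refine Finset.sum_congr rfl fun b hb => ?_
  rw [nsmul_eq_mul, nsmul_eq_mul, hchoose, ← Finset.HasAntidiagonal.mem_antidiagonal.1 hb, hchoose]
  have h1 : ((b.1 + b.2).factorial : ℂ) ≠ 0 := by exact_mod_cast (b.1 + b.2).factorial_ne_zero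
  field_simp

/-- The coefficient of `phi (q + l) r` in `-θ^l A(θ)^(k - 1 - l)`, for `(p, q, r) = t`. -/
def expansionCoeff (k l : ℕ) (t : ℕ × ℕ × ℕ) : ℂ :=
  Complex.I ^ (l + 1) * (-1) ^ (k + 1) * ((-Complex.I * Real.pi) ^ t.1 / 2 ^ (t.1 + t.2.1)) *
    (((k - 1 - l).factorial : ℂ) / (t.1.factorial * t.2.1.factorial * t.2.2.factorial))

theorem neg_integrand_factor_eq {k l : ℕ} (hkl : l + 1 ≤ k) {θ : ℝ}
    (hθ : θ ∈ Set.Ioo 0 (2 * Real.pi)) :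
    ((-1 * (θ ^ l * A θ ^ ((k : ℤ) - 1 - (l : ℤ))) : ℝ) : ℂ) =
      ∑ t ∈ triples (k - 1 - l), expansionCoeff k l t * phi (t.2.1 + l) t.2.2 θ := by
  obtain ⟨K, rfl⟩ := Nat.exists_eq_add_of_le hkl
  have h1 : ((l + 1 + K : ℕ) : ℤ) - 1 - (l : ℤ) = (K : ℕ) := by push_cast; ring
  have h2 : l + 1 + K - 1 - l = K := by omega
  rw [h1, zpow_natCast]
  push_cast
  rw [A_eq_of_mem_Ioo hθ, show ∀ u v w : ℂ, -(u + v - w) = -1 * (-w + v + u) by intros; ring,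
    mul_pow, add_add_pow, h2]
  simp only [Finset.mul_sum]
  refine Finset.sum_congr rfl fun t _ => ?_
  rw [expansionCoeff, h2, phi]
  have hI : (Complex.I ^ (l + 1)) * Complex.I * Complex.I ^ l = (-1) ^ (l + 1) := by
    rw [mul_assoc, ← pow_succ', ← mul_pow, Complex.I_mul_I]
  have h3 : (-(Complex.I * Real.pi / 2)) ^ t.1 * (Complex.I * θ / 2) ^ t.2.1 =
      (-Complex.I * Real.pi) ^ t.1 / 2 ^ (t.1 + t.2.1) * (Complex.I * θ) ^ t.2.1 := by
    rw [pow_add, ← neg_mul_eq_neg_mul, ← neg_div, div_pow, div_pow]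
    field_simp
  have h4 : (-1 : ℂ) ^ (l + 1 + K + 1) * (-1) ^ (l + 1) = -1 * (-1) ^ K := by
    rw [← pow_add, show l + 1 + K + 1 + (l + 1) = 2 * (l + 1) + (K + 1) by ring, pow_add, pow_mul]
    simp [pow_succ]
  have h5 : (Complex.I * θ) ^ (t.2.1 + l) =
      (Complex.I * θ) ^ t.2.1 * (Complex.I ^ l * (θ : ℂ) ^ l) := by rw [pow_add, mul_pow _ _ l]
  rw [h3, h5]
  generalize (-Complex.I * Real.pi) ^ t.1 / 2 ^ (t.1 + t.2.1) = P
  generalize (K.factorial : ℂ) / (t.1.factorial * t.2.1.factorial * t.2.2.factorial) = M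
  generalize (Complex.I * (θ : ℂ)) ^ t.2.1 = Y
  generalize (-Complex.log (1 - Complex.exp (Complex.I * θ))) ^ t.2.2 = Z
  linear_combination (-((θ : ℂ) ^ l * M * P * Y * Z)) * ((-1) ^ (l + 1 + K + 1) * hI + h4)

/-! ### The log-sine integral -/

theorem integrableOn_integrand {n : ℕ} (k l : Fin n → ℕ) (hkl : ∀ u, l u + 1 ≤ k u) {σ : ℝ}
    (hσ : σ ∈ Set.Icc 0 (2 * Real.pi)) : IntegrableOn (integrand k l) (simplex n σ) := by
  have hfac : ∀ u, IntegrableOn (fun θ : ℝ => θ ^ l u * A θ ^ ((k u : ℤ) - 1 - (l u : ℤ)))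
      (Set.Ioo 0 (2 * Real.pi)) := by
    intro u
    obtain ⟨K, hK⟩ := Nat.exists_eq_add_of_le (hkl u)
    have h1 : (k u : ℤ) - 1 - (l u : ℤ) = (K : ℕ) := by rw [hK]; push_cast; ring
    simp only [h1, zpow_natCast]
    have hb := (((intervalIntegrable_iff_integrableOn_Ioc_of_le (by positivity)).1
      (intervalIntegrable_A_pow 0 K)).mono_set Set.Ioo_subset_Ioc_self).const_mul
        ((2 * Real.pi) ^ l u)
    refine hb.mono' ?_ ?_
    · exact ((measurable_id.pow_const _).mul (measurable_A.pow_const _)).aestronglyMeasurable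
    · refine (ae_restrict_mem measurableSet_Ioo).mono fun θ hθ => ?_
      rw [norm_mul, norm_pow, norm_pow, Real.norm_of_nonneg hθ.1.le, Real.norm_eq_abs, abs_zero,
        add_zero]
      have := hθ.1.le
      have := hθ.2.le
      gcongr
  have hpi : IntegrableOn (integrand k l) (Set.univ.pi fun _ => Set.Ioo 0 (2 * Real.pi)) := by
    rw [IntegrableOn, volume_pi, Measure.restrict_pi_pi]
    exact Integrable.fintype_prod fun u => hfac u
  refine hpi.mono_set fun θ hθ u _ => ⟨(hθ.2 u).1, (hθ.2 u).2.trans_le hσ.2⟩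

/-- The tuples of triples, reorganized as triples of tuples. -/
theorem sum_piFinset_triples {n : ℕ} (K : Fin n → ℕ) (φ : (Fin n → ℕ) × (Fin n → ℕ) × (Fin n → ℕ) → ℂ) :
    ∑ x ∈ Fintype.piFinset fun u => triples (K u),
        φ (fun u => (x u).1, fun u => (x u).2.1, fun u => (x u).2.2) =
      ∑ x ∈ (Finset.Iic K ×ˢ Finset.Iic K ×ˢ Finset.Iic K) with x.1 + x.2.1 + x.2.2 = K, φ x := by
  refine Finset.sum_bij' (fun x _ => (fun u => (x u).1, fun u => (x u).2.1, fun u => (x u).2.2))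
    (fun y _ u => (y.1 u, y.2.1 u, y.2.2 u)) ?_ ?_ ?_ ?_ ?_
  · intro x hx
    rw [Fintype.mem_piFinset] at hx
    have h := fun u => mem_triples.1 (hx u)
    simp only [Finset.mem_filter, Finset.mem_product, Finset.mem_Iic, Pi.le_def, funext_iff,
      Pi.add_apply]
    exact ⟨⟨fun u => by have := h u; omega, fun u => by have := h u; omega,
      fun u => by have := h u; omega⟩, h⟩
  · intro y hy
    have h := (Finset.mem_filter.1 hy).2
    exact Fintype.mem_piFinset.2 fun u => mem_triples.2 (congrFun h u)
  · intro x _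
    rfl
  · intro y _
    rfl
  · intro x _
    rfl

theorem Ls_eq_sum {n : ℕ} (k l : Fin n → ℕ) (hkl : ∀ u, l u + 1 ≤ k u) {σ : ℝ}
    (hσ : σ ∈ Set.Icc 0 (2 * Real.pi)) :
    (Ls k l σ : ℂ) = Complex.I ^ ((∑ u, l u) + n) * (-1) ^ ((∑ u, k u) + n) *
      ∑ x ∈ (Finset.Iic (k - 1 - l) ×ˢ Finset.Iic (k - 1 - l) ×ˢ Finset.Iic (k - 1 - l)) with
          x.1 + x.2.1 + x.2.2 = k - 1 - l,
        (-Complex.I * Real.pi) ^ (∑ u, x.1 u) / 2 ^ ((∑ u, x.1 u) + ∑ u, x.2.1 u) *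
          (∏ u, ((k u - 1 - l u).factorial : ℂ) /
            ((x.1 u).factorial * (x.2.1 u).factorial * (x.2.2 u).factorial)) *
          F (List.ofFn (x.2.1 + l)) (List.ofFn x.2.2) σ := by
  have h1 : (Ls k l σ : ℂ) =
      iterInt n (fun u θ => ((-1 * (θ ^ l u * A θ ^ ((k u : ℤ) - 1 - (l u : ℤ))) : ℝ) : ℂ)) σ := by
    have h := iteratedIntegral_prod_mul
      (fun u θ => θ ^ l u * A θ ^ ((k u : ℤ) - 1 - (l u : ℤ))) 1 σ
    simp only [mul_one, Complex.ofReal_one] at h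
    simp only [Complex.ofReal_mul (-1)]
    rw [iterInt_const_mul, Ls, Complex.ofReal_mul, ← h]
    simp
    rfl
  rw [h1, iterInt_congr (fun u θ hθ => neg_integrand_factor_eq (hkl u) hθ) hσ,
    iterInt_sum _ (fun u t θ => expansionCoeff (k u) (l u) t * phi (t.2.1 + l u) t.2.2 θ)
      (fun u t => (intervalIntegrable_phi _ _).const_mul _) hσ, ← sum_piFinset_triples,
    Finset.mul_sum]
  refine Finset.sum_congr rfl fun x _ => ?_
  rw [iterInt_const_mul, F_eq_iterInt _ _ hσ]
  simp only [expansionCoeff, Finset.prod_mul_distrib, Finset.prod_div_distrib,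
    Finset.prod_pow_eq_pow_sum, Finset.sum_add_distrib, Finset.sum_const, Finset.card_univ,
    Fintype.card_fin, smul_eq_mul, mul_one, Pi.add_apply]
  ring

end

end

end LogSine

theorem mainTheorem1 {n : ℕ} (k l : Fin n → ℕ) (hkl : ∀ u, l u + 1 ≤ k u) :
    (∀ σ ∈ Set.Icc (0 : ℝ) (2 * Real.pi),
      MeasureTheory.IntegrableOn (LogSine.integrand k l) (LogSine.simplex n σ) ∧
      (LogSine.Ls k l σ : ℂ) =
        Complex.I ^ ((∑ u, l u) + n) * (-1) ^ ((∑ u, k u) + n) *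
          ∑ x ∈ (Finset.Iic (k - 1 - l) ×ˢ Finset.Iic (k - 1 - l) ×ˢ Finset.Iic (k - 1 - l)) with
              x.1 + x.2.1 + x.2.2 = k - 1 - l,
            (-Complex.I * Real.pi) ^ (∑ u, x.1 u) / 2 ^ ((∑ u, x.1 u) + ∑ u, x.2.1 u) *
              (∏ u, ((k u - 1 - l u).factorial : ℂ) /
                ((x.1 u).factorial * (x.2.1 u).factorial * (x.2.2 u).factorial)) *
              LogSine.F (List.ofFn (x.2.1 + l)) (List.ofFn x.2.2) σ) ∧
    ∀ q r : Fin n → ℕ,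
      (fun σ : Set.Icc (0 : ℝ) (2 * Real.pi) => LogSine.F (List.ofFn q) (List.ofFn r) σ) ∈
        Submodule.span LogSine.QI LogSine.elementaryProducts :=
  ⟨fun _ hσ => ⟨LogSine.integrableOn_integrand k l hkl hσ, LogSine.Ls_eq_sum k l hkl hσ⟩,
    fun q r => LogSine.F_mem_elementarySpan (by simp)⟩
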